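/- Let $m\ge 1$. A $\mathbb Z/m\mathbb Z$-graded Frobenius $\star$-algebra is a finite-dimensional unital associative $\mathbb C$-algebra $\mathcal A=\bigoplus_{r\in\mathbb Z/m\mathbb Z}\mathcal A_r$ with $\mathcal A_r\mathcal A_s\subseteq\mathcal A_{r+s}$, equipped with a conjugate-linear map $\star:\mathcal A\to\mathcal A$ satisfying $(a^\star)^\star=a$, $(ab)^\star=b^\star a^\star$, $(\mathcal A_r)^\star\subseteq\mathcal A_{-r}$, and with a linear functional $\lambda_0:\mathcal A_0\to\mathbb C$ satisfying $\lambda_0(ab)=\lambda_0(ba)$, such that, with $\lambda$ the extension of $\lambda_0$ to $\mathcal A$ by zero on $\mathcal A_r$, $r\ne 0$, the form $\langle a,b\rangle=\lambda(ab^\star)$ is a positive definite hermitian form on $\mathcal A$. Then $\phi:\mathcal A\to\mathcal A^*$, $\phi(a)=\lambda(-\cdot a)$, is a linear isomorphism. For linear functionals $\gamma,\delta$ on $\mathcal A_1$, extended to $\mathcal A$ by zero on the other components, put $\langle\gamma,\delta\rangle=\langle\phi^{-1}(\gamma),\phi^{-1}(\delta)\rangle$. For a left $\mathcal A_0$-module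 $M$, the induced module is the quotient of the graded $\mathcal A$-module $\mathcal A\otimes_{\mathcal A_0}M$ by its largest graded submodule whose component of degree $0$ is zero, and $M^{r}$ denotes its component of degree $r$. Let $\mathrm{Sim}(\mathcal A_0)^{\mathbb Z/m\mathbb Z}$ be the set of isomorphism classes of simple left $\mathcal A_0$-modules $M$ with $M^{r}\cong M$ as $\mathcal A_0$-modules for all $r\in\mathbb Z/m\mathbb Z$. A twisted class functional on $\mathcal A_1$ is a linear functional $\gamma:\mathcal A_1\to\mathbb C$ with $\gamma(ax)=\gamma(xa)$ for all $a\in\mathcal A_0$, $x\in\mathcal A_1$. Theorem. Let $\mathcal A$ be a $\mathbb Z/m\mathbb Z$-graded Frobenius $\star$-algebra. (0) Every $M\in\mathrm{Sim}(\mathcal A_0)^{\mathbb Z/m\mathbb Z}$ extends to an $\mathcal A$-module. For an extension $\tilde M$ of $M$ with character $\chi_{\tilde M}:\mathcal A\to\mathbb C$, let $\tilde\chi_M=\chi_{\tilde M}|_{\mathcal A_1}$ be the twisted character. (1) Let $M\in\mathrm{Sim}(\mathcal A_0)^{\mathbb Z/m\mathbb Z}$, with any extension $\tilde M$. Then there is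 a central idempotent $e_{\tilde M}$ of $\mathcal A$ such that $\mathcal A e_{\tilde M}$ is the sum of all left ideals of $\mathcal A$ isomorphic to $\tilde M$, there is a scalar $c_M\in\mathbb C$ with $\phi^{-1}(\chi_{\tilde M})=c_M e_{\tilde M}$ (both are unique), and $$\langle\tilde\chi_M,\tilde\chi_M\rangle=\frac{|c_M|^2\,\langle e_{\tilde M},e_{\tilde M}\rangle}{m}.$$ (2) If $M,N\in\mathrm{Sim}(\mathcal A_0)^{\mathbb Z/m\mathbb Z}$ are not isomorphic, then $\langle\tilde\chi_M,\tilde\chi_N\rangle=0$ for all choices of the extensions $\tilde M,\tilde N$. (3) If one extension is chosen for a representative of each class in $\mathrm{Sim}(\mathcal A_0)^{\mathbb Z/m\mathbb Z}$, then the twisted characters $\{\tilde\chi_M: M\in\mathrm{Sim}(\mathcal A_0)^{\mathbb Z/m\mathbb Z}\}$ form an orthogonal basis of the space of twisted class functionals on $\mathcal A_1$. -/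

import Mathlib

open scoped TensorProduct

universe u v w

namespace TwistedFrobenius

noncomputable section

/-! ### Graded Frobenius star-algebras -/

section Algebra

variable {m : ℕ} {A : Type u} [Ring A] [Algebra ℂ A]

/-- The projection of `A = ⨁ 𝒜 r` onto its component of degree `r`. -/
def gradeProj (𝒜 : ZMod m → Submodule ℂ A) [GradedAlgebra 𝒜] (r : ZMod m) : A →ₗ[ℂ] 𝒜 r :=
  DirectSum.component ℂ (ZMod m) (fun i => 𝒜 i) r ∘ₗ
    (DirectSum.decomposeLinearEquiv 𝒜).toLinearMap

/-- A functional on `𝒜 r`, extended to `A` by zero on the other components. -/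
def extendByZero (𝒜 : ZMod m → Submodule ℂ A) [GradedAlgebra 𝒜] (r : ZMod m)
    (γ : Module.Dual ℂ (𝒜 r)) : Module.Dual ℂ A :=
  γ ∘ₗ gradeProj 𝒜 r

/-- The data and axioms which make the `ℤ/mℤ`-graded algebra `A`, with its conjugate linear
anti-involution `star`, a `ℤ/mℤ`-graded Frobenius `⋆`-algebra: a class functional `lam0` on the
subalgebra `𝒜 0` such that, with `lam` its extension by zero, `⟨a, b⟩ = lam (a * star b)` is a
positive definite hermitian form on `A`; and `star` maps degree `r` to degree `-r`. -/
structure FrobeniusStar [StarRing A] [StarModule ℂ A]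
    (𝒜 : ZMod m → Submodule ℂ A) [GradedAlgebra 𝒜] where
  lam0 : Module.Dual ℂ (𝒜 0)
  lam0_mul_comm : ∀ a b : 𝒜 0, lam0 (a * b) = lam0 (b * a)
  star_mem : ∀ (r : ZMod m) (a : A), a ∈ 𝒜 r → star a ∈ 𝒜 (-r)
  hermitian : ∀ a b : A, extendByZero 𝒜 0 lam0 (a * star b)
    = (starRingEnd ℂ) (extendByZero 𝒜 0 lam0 (b * star a))
  pos : ∀ a : A, a ≠ 0 → 0 < (extendByZero 𝒜 0 lam0 (a * star a)).re

namespace FrobeniusStar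

variable [StarRing A] [StarModule ℂ A] {𝒜 : ZMod m → Submodule ℂ A} [GradedAlgebra 𝒜]
  (F : FrobeniusStar 𝒜)

/-- The functional `λ` on `A`. -/
def lam : Module.Dual ℂ A := extendByZero 𝒜 0 F.lam0

/-- The positive definite hermitian form `⟨a, b⟩ = λ(a b⋆)` on `A`. -/
def form (a b : A) : ℂ := F.lam (a * star b)

/-- The linear map `φ : A → A*`, `φ(a) = λ(- · a)`. -/
def phiHom : A →ₗ[ℂ] Module.Dual ℂ A :=
  LinearMap.mk₂ ℂ (fun a x => F.lam (x * a))
    (fun a b x => by simp [mul_add]) (fun c a x => by simp)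
    (fun a x y => by simp [add_mul]) (fun c a x => by simp)

theorem phiHom_injective : Function.Injective F.phiHom := by
  rw [← LinearMap.ker_eq_bot, LinearMap.ker_eq_bot']
  intro a ha
  by_contra hne
  have h1 : F.lam (star a * a) = 0 := by
    have := LinearMap.congr_fun ha (star a)
    simpa [phiHom] using this
  have h2 := F.pos (star a) (by simpa using hne)
  rw [star_star] at h2
  have h3 : extendByZero 𝒜 0 F.lam0 (star a * a) = 0 := h1
  rw [h3] at h2
  simp at h2

/-- The isomorphism `φ : A ≅ A*`, `φ(a) = λ(- · a)`. -/
def phi [FiniteDimensional ℂ A] : A ≃ₗ[ℂ] Module.Dual ℂ A :=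
  LinearEquiv.ofBijective F.phiHom ⟨F.phiHom_injective,
    (LinearMap.injective_iff_surjective_of_finrank_eq_finrank
      (Subspace.dual_finrank_eq (K := ℂ) (V := A)).symm).1 F.phiHom_injective⟩

/-- The hermitian form on functionals on `𝒜 r`: extend by zero to `A`, transport by `φ`. -/
def dualForm [FiniteDimensional ℂ A] (r : ZMod m) (γ δ : Module.Dual ℂ (𝒜 r)) : ℂ :=
  F.form (F.phi.symm (extendByZero 𝒜 r γ)) (F.phi.symm (extendByZero 𝒜 r δ))

end FrobeniusStar

theorem zero_mul_mem {𝒜 : ZMod m → Submodule ℂ A} [GradedAlgebra 𝒜] {r : ZMod m} (a : 𝒜 0)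
    {x : A} (hx : x ∈ 𝒜 r) : (a : A) * x ∈ 𝒜 r := by
  simpa using SetLike.mul_mem_graded a.2 hx

theorem mul_zero_mem {𝒜 : ZMod m → Submodule ℂ A} [GradedAlgebra 𝒜] {r : ZMod m} (a : 𝒜 0)
    {x : A} (hx : x ∈ 𝒜 r) : x * (a : A) ∈ 𝒜 r := by
  simpa using SetLike.mul_mem_graded hx a.2

/-- The space of twisted class functionals on the `𝒜 0`-bimodule `𝒜 r`: the functionals `γ` with
`γ(a x) = γ(x a)` for all `a ∈ 𝒜 0` and `x ∈ 𝒜 r`. -/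
def twistedClassFunctionals (𝒜 : ZMod m → Submodule ℂ A) [GradedAlgebra 𝒜] (r : ZMod m) :
    Submodule ℂ (Module.Dual ℂ (𝒜 r)) where
  carrier := {γ | ∀ (a : 𝒜 0) (x : 𝒜 r),
    γ ⟨(a : A) * x, zero_mul_mem a x.2⟩ = γ ⟨(x : A) * a, mul_zero_mem a x.2⟩}
  add_mem' := by
    intro γ δ hγ hδ a x
    simp only [LinearMap.add_apply, hγ a x, hδ a x]
  zero_mem' := by intro a x; rfl
  smul_mem' := by
    intro c γ hγ a x
    simp only [LinearMap.smul_apply, hγ a x]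

end Algebra

/-! ### Induction of `𝒜 0`-modules and the partial action of `ℤ/mℤ` -/

section Induction

variable {m : ℕ} {A : Type u} [Ring A] [Algebra ℂ A]
  (𝒜 : ZMod m → Submodule ℂ A) [GradedAlgebra 𝒜]
  (M : Type v) [AddCommGroup M] [Module ℂ M] [Module (𝒜 0) M]

/-- The relations `ab ⊗ x = a ⊗ bx`, for `b ∈ 𝒜 0`, in `A ⊗_ℂ M`. -/
def balancedRel : Submodule A (A ⊗[ℂ] M) :=
  Submodule.span A {t | ∃ (a : A) (b : 𝒜 0) (x : M),
    t = (a * (b : A)) ⊗ₜ[ℂ] x - a ⊗ₜ[ℂ] (b • x)}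

/-- The left `A`-module `A ⊗_{𝒜 0} M`. -/
abbrev TensorInd : Type (max u v) := (A ⊗[ℂ] M) ⧸ balancedRel 𝒜 M

/-- The component `𝒜 r ⊗_{𝒜 0} M` of degree `r` of `A ⊗_{𝒜 0} M`. -/
def tensorGrade (r : ZMod m) : Submodule ℂ (TensorInd 𝒜 M) :=
  Submodule.span ℂ {t | ∃ a ∈ 𝒜 r, ∃ x : M,
    t = (balancedRel 𝒜 M).mkQ (a ⊗ₜ[ℂ] x)}

/-- `U` is a graded submodule of `A ⊗_{𝒜 0} M` whose component of degree zero vanishes. -/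
def IsNullGraded (U : Submodule A (TensorInd 𝒜 M)) : Prop :=
  U.restrictScalars ℂ = ⨆ r : ZMod m, U.restrictScalars ℂ ⊓ tensorGrade 𝒜 M r ∧
    U.restrictScalars ℂ ⊓ tensorGrade 𝒜 M 0 = ⊥

/-- The null socle of `A ⊗_{𝒜 0} M`, the largest null graded submodule. -/
def nullSocle : Submodule A (TensorInd 𝒜 M) := sSup {U | IsNullGraded 𝒜 M U}

/-- The induced module, the quotient of `A ⊗_{𝒜 0} M` by its null socle. -/
abbrev Induced : Type (max u v) := TensorInd 𝒜 M ⧸ nullSocle 𝒜 M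

/-- The partial action of `ℤ/mℤ`: the conjugate `M^r` of the `𝒜 0`-module `M` is the component of
degree `r` of the induced module. -/
def conjugate (r : ZMod m) : Submodule ℂ (Induced 𝒜 M) :=
  (tensorGrade 𝒜 M r).map ((nullSocle 𝒜 M).mkQ.restrictScalars ℂ)

variable {𝒜 M} in
theorem smul_mem_tensorGrade {r : ZMod m} (a : 𝒜 0) {t : TensorInd 𝒜 M}
    (ht : t ∈ tensorGrade 𝒜 M r) : (a : A) • t ∈ tensorGrade 𝒜 M r := by
  induction ht using Submodule.span_induction with
  | mem t ht =>
    obtain ⟨b, hb, x, rfl⟩ := ht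
    exact Submodule.subset_span ⟨(a : A) * b, zero_mul_mem a hb, x, rfl⟩
  | zero => rw [smul_zero]; exact zero_mem _
  | add s t _ _ hs ht => rw [smul_add]; exact add_mem hs ht
  | smul c t _ ht => rw [smul_comm]; exact Submodule.smul_mem _ c ht

variable {𝒜 M} in
theorem smul_mem_conjugate {r : ZMod m} (a : 𝒜 0) {t : Induced 𝒜 M}
    (ht : t ∈ conjugate 𝒜 M r) : (a : A) • t ∈ conjugate 𝒜 M r := by
  obtain ⟨s, hs, rfl⟩ := ht
  exact ⟨(a : A) • s, smul_mem_tensorGrade a hs, rfl⟩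

/-- `M` is `ℤ/mℤ`-invariant: `M^r` and `M` are isomorphic `𝒜 0`-modules for every `r`. -/
def IsInvariant : Prop :=
  ∀ r : ZMod m, ∃ f : conjugate 𝒜 M r ≃ₗ[ℂ] M,
    ∀ (a : 𝒜 0) (t : conjugate 𝒜 M r),
      f ⟨(a : A) • (t : Induced 𝒜 M), smul_mem_conjugate a t.2⟩ = a • f t

end Induction

/-! ### Extensions to `A` and twisted characters -/

section Extension

variable {m : ℕ} {A : Type u} [Ring A] [Algebra ℂ A]
  (𝒜 : ZMod m → Submodule ℂ A) [GradedAlgebra 𝒜]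
  (M : Type v) [AddCommGroup M] [Module ℂ M] [Module (𝒜 0) M]

/-- An extension of the `𝒜 0`-module `M` to an `A`-module: an action of `A` on the space `M` which
restricts to the given action of `𝒜 0`. -/
structure Extension where
  action : A →ₐ[ℂ] Module.End ℂ M
  action_zero : ∀ (a : 𝒜 0) (x : M), action (a : A) x = a • x

namespace Extension

variable {𝒜 M} (E : Extension 𝒜 M)

/-- The space `M`, regarded as an `A`-module through the extension `E`. -/
def Space (_E : Extension 𝒜 M) : Type v := M

instance : AddCommGroup E.Space := inferInstanceAs (AddCommGroup M)

instance : Module A E.Space :=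
  letI : Module (Module.End ℂ M) E.Space := inferInstanceAs (Module (Module.End ℂ M) M)
  Module.compHom E.Space E.action.toRingHom

/-- The character of the extension, a functional on `A`. -/
def character : Module.Dual ℂ A := LinearMap.trace ℂ M ∘ₗ E.action.toLinearMap

/-- The twisted character, the restriction to `𝒜 1` of the character of the extension. -/
def twistedCharacter : Module.Dual ℂ (𝒜 1) := E.character ∘ₗ (𝒜 1).subtype

/-- `e` is the central idempotent of `A` that belongs to the `A`-module `E.Space`: it generates the
sum of all left ideals of `A` isomorphic to this module. -/
def IsCentralIdempotent (e : A) : Prop :=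
  e ∈ Subring.center A ∧ e * e = e ∧ Ideal.span {e} = isotypicComponent A A E.Space

end Extension

end Extension

end

end TwistedFrobenius

set_option linter.unusedSectionVars false

namespace TwistedFrobenius

/-! ### Semisimple rings and their central idempotents -/

section Semisimple

/-! Positivity makes `star` proper, so `A` and `𝒜 0` are semisimple and each simple `𝒜 0`-module `M`
has a block idempotent `f` in `𝒜 0`. The proof rests on one equivalence: `M` is invariant exactly
when some `u` of degree 1 commutes with `𝒜 0` and satisfies `u ^ m = f`, `f * u = u`
(`IsBlock.exists_isTwist_of_isInvariant`, `IsTwist.isInvariant`). Such a `u` is invertible in the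
block and moves every degree to degree 0; with adjoints, `f` and `u` become central in `A`
(`IsTwist.comm`). Hence `A f` is `𝒜 0 f` with a central `m`-th root `u` of its unit adjoined. An
extension of `M` lets `u` act by an `m`-th root of unity, and rescaling makes it act by 1. The
idempotent of the extension is then `P / m` with `P = ∑ f u ^ k`. On `𝒜 0`, `b ↦ λ(b f)` is a
nonzero multiple of the trace on `M`. So the character is represented by a multiple of `P` and the
twisted character by the same multiple of its component `f u ^ (-1)` (`Extension.exists_twist`).
Positivity forces `u * star u = f`, which gives the norm formula; orthogonality of distinct blocks
gives the vanishing. For the basis, a twisted class functional is represented by some `z` of degree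
-1 commuting with `𝒜 0`. In an invariant block Schur's lemma makes `z f` a multiple of `f u ^ (-1)`;
in any other block `z` must vanish, since a nonzero part would produce a twist
(`span_twistedCharacter`). -/

theorem isSemisimpleRing_of_proper_involution {R : Type*} [Ring R] [IsArtinianRing R] (σ : R → R)
    (hmul : ∀ a b, σ (a * b) = σ b * σ a) (hinv : ∀ a, σ (σ a) = a)
    (hproper : ∀ a, σ a * a = 0 → a = 0) : IsSemisimpleRing R := by
  have hone : σ 1 = 1 := by
    have h := hmul (σ 1) 1
    rw [mul_one, hinv, mul_one] at h
    exact h.symm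
  have hpow : ∀ y, σ y = y → ∀ k, σ (y ^ k) = y ^ k := by
    intro y hy k
    induction k with
    | zero => simpa using hone
    | succ k ih => rw [pow_succ, hmul, ih, hy, ← pow_succ', pow_succ]
  -- A self-adjoint nilpotent vanishes: its square is `σ y * y`, so properness halves the exponent.
  -- It is applied below to `σ x * x` in the nilpotent radical.
  have hnil : ∀ y, σ y = y → ∀ k, y ^ 2 ^ k = 0 → y = 0 := by
    intro y hy k
    induction k with
    | zero => simp
    | succ k ih =>
      intro h
      apply ih
      apply hproper
      rw [hpow y hy, ← sq, ← pow_mul, ← pow_succ, h]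
  rw [IsArtinianRing.isSemisimpleRing_iff_jacobson, eq_bot_iff]
  intro x hx
  obtain ⟨n, hn⟩ := IsSemiprimaryRing.isNilpotent (R := R)
  have hy : σ x * x ∈ Ring.jacobson R := Ideal.mul_mem_left _ _ hx
  have h1 : (σ x * x) ^ 2 ^ n = 0 := by
    have h2 : (σ x * x) ^ n = 0 := by
      have := Ideal.pow_mem_pow hy n
      rw [hn] at this
      simpa using this
    exact pow_eq_zero_of_le (Nat.lt_two_pow_self).le h2
  have h3 := hnil (σ x * x) (by rw [hmul, hinv]) n h1
  exact hproper x h3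

variable {R : Type u} [Ring R] [IsSemisimpleRing R]

/-- Semiprimeness: an idempotent generator `g = r * y` of the left ideal of `y` satisfies `g = g * g
= r * (y * r * y) = 0`. -/
theorem eq_zero_of_mul_mul_eq_zero {y : R} (hy : ∀ r, y * r * y = 0) : y = 0 := by
  obtain ⟨g, hg, hI⟩ := IsSemisimpleRing.ideal_eq_span_idempotent (Ideal.span {y})
  obtain ⟨r, hr⟩ := Ideal.mem_span_singleton'.1 (hI ▸ Ideal.mem_span_singleton_self g)
  have hg0 : g = 0 := by
    rw [← hg.eq, ← hr, mul_assoc, ← mul_assoc y, hy, mul_zero]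
  have : y ∈ Ideal.span {g} := hI ▸ Ideal.mem_span_singleton_self y
  simpa [hg0] using this

/-- Two-sidedness gives `e * x * e = e * x`, hence `e * r * (1 - e) = 0`. The opposite corner `(1 -
e) * x * e` then vanishes by semiprimeness. -/
theorem exists_central_idempotent (I : Ideal R) [I.IsTwoSided] :
    ∃ e : R, (∀ x, e * x = x * e) ∧ e * e = e ∧ Ideal.span {e} = I := by
  obtain ⟨e, he, hI⟩ := IsSemisimpleRing.ideal_eq_span_idempotent I
  have heI : e ∈ I := hI ▸ Ideal.mem_span_singleton_self e
  have h1 : ∀ x, e * x * e = e * x := by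
    intro x
    have : e * x ∈ I := I.mul_mem_right x heI
    rw [hI] at this
    obtain ⟨r, hr⟩ := Ideal.mem_span_singleton'.1 this
    rw [← hr, mul_assoc, he.eq]
  have h2 : ∀ x, (1 - e) * x * e = 0 := by
    intro x
    apply eq_zero_of_mul_mul_eq_zero
    intro r
    have : e * r * (1 - e) = 0 := by rw [mul_sub, mul_one, h1, sub_self]
    calc (1 - e) * x * e * r * ((1 - e) * x * e)
        = (1 - e) * x * (e * r * (1 - e)) * x * e := by noncomm_ring
      _ = 0 := by rw [this]; simp
  refine ⟨e, fun x => ?_, he.eq, hI.symm⟩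
  have h3 := h2 x
  rw [sub_mul, sub_mul, one_mul, sub_eq_zero] at h3
  rw [h3, h1]

end Semisimple

/-! ### The block idempotent of a simple module -/

section Block

variable {R : Type u} [Ring R] {M : Type v} [AddCommGroup M] [Module R M]

variable (M) in
/-- `f` is the central idempotent of `R` which belongs to the simple module `M`. -/
structure IsBlock (f : R) : Prop where
  comm : ∀ x, f * x = x * f
  idem : f * f = f
  span_eq : Ideal.span {f} = isotypicComponent R R M
  smul_eq : ∀ x : M, f • x = x

/-- The isotypic component is a sum of images of maps `M → R`, so values `g x` suffice. The additive
map `ψ` lets `a` lie outside `R`, as needed for the inclusion of `𝒜 0` in `A`. -/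
theorem IsBlock.mul_eq_zero {f : R} (hf : IsBlock M f) {B : Type*} [NonUnitalNonAssocSemiring B]
    (ψ : R →+ B) (a : B) (h : ∀ (g : M →ₗ[R] R) (x : M), a * ψ (g x) = 0) : a * ψ f = 0 := by
  have hmem : f ∈ isotypicComponent R R M := hf.span_eq ▸ Ideal.mem_span_singleton_self f
  clear hf
  rw [isotypicComponent, sSup_eq_iSup'] at hmem
  induction hmem using Submodule.iSup_induction' with
  | mem m b hb =>
    obtain ⟨e⟩ := m.2
    simpa using h (m.1.subtype ∘ₗ e.symm.toLinearMap) (e ⟨b, hb⟩)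
  | zero => simp
  | add b c _ _ hb hc => rw [map_add, mul_add, hb, hc, add_zero]

theorem IsBlock.mul_eq_zero_of_smul {f : R} (hf : IsBlock M f) {k : R}
    (hk : ∀ x : M, k • x = 0) : k * f = 0 := by
  refine hf.mul_eq_zero (AddMonoidHom.id R) k fun g x => ?_
  rw [AddMonoidHom.id_apply, ← smul_eq_mul, ← map_smul, hk, map_zero]

theorem IsBlock.ne_zero {f : R} (hf : IsBlock M f) [Nontrivial M] : f ≠ 0 := by
  rintro rfl
  obtain ⟨x, hx⟩ := exists_ne (0 : M)
  exact hx (by rw [← hf.smul_eq x, zero_smul])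

/-- The isotypic component is fully invariant, hence two-sided. As `M` embeds in it as a left ideal,
its unit `f` acts on `M` as the identity. -/
theorem exists_isBlock [IsSemisimpleRing R] [IsSimpleModule R M] : ∃ f : R, IsBlock M f := by
  have : Ideal.IsTwoSided (isotypicComponent R R M) :=
    isFullyInvariant_iff_isTwoSided.1 (Submodule.IsFullyInvariant.isotypicComponent R R M)
  obtain ⟨f, hcomm, hidem, hspan⟩ := exists_central_idempotent (isotypicComponent R R M)
  refine ⟨f, hcomm, hidem, hspan, fun x => ?_⟩
  obtain ⟨I, ⟨e⟩⟩ := IsSemisimpleRing.exists_linearEquiv_ideal_of_isSimpleModule R M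
  have hx : (e x : R) ∈ Ideal.span {f} := by
    rw [hspan]
    exact (le_sSup ⟨e.symm⟩ : I ≤ isotypicComponent R R M) (e x).2
  obtain ⟨r, hr⟩ := Ideal.mem_span_singleton'.1 hx
  apply e.injective
  apply Subtype.ext
  rw [map_smul, Submodule.coe_smul, smul_eq_mul, ← hr, hcomm, mul_assoc, hidem]

theorem IsBlock.smul_eq_zero {N : Type w} [AddCommGroup N] [Module R N] [IsSimpleModule R M]
    [IsSimpleModule R N] {f : R} (hf : IsBlock M f) (h : ¬ Nonempty (M ≃ₗ[R] N)) (y : N) :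
    f • y = 0 := by
  let t : R →ₗ[R] N := LinearMap.toSpanSingleton R N y
  have hmem : f ∈ isotypicComponent R R M := hf.span_eq ▸ Ideal.mem_span_singleton_self f
  have hle : isotypicComponent R R M ≤ LinearMap.ker t := by
    refine sSup_le ?_
    rintro m ⟨e⟩ b hb
    rcases (t ∘ₗ m.subtype ∘ₗ e.symm.toLinearMap).bijective_or_eq_zero with h1 | h1
    · exact (h ⟨LinearEquiv.ofBijective _ h1⟩).elim
    · simpa using LinearMap.congr_fun h1 (e ⟨b, hb⟩)
  simpa [t] using hle hmem

theorem IsBlock.mul_eq_zero_of_not_equiv {N : Type w} [AddCommGroup N] [Module R N]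
    [IsSimpleModule R M] [IsSimpleModule R N] {f g : R} (hf : IsBlock M f) (hg : IsBlock N g)
    (h : ¬ Nonempty (M ≃ₗ[R] N)) : f * g = 0 :=
  hg.mul_eq_zero_of_smul (hf.smul_eq_zero h)

end Block

/-! ### Simple modules over finite-dimensional complex algebras -/

section Simple

theorem finiteDimensional_of_isSimpleModule (R : Type u) [Ring R] [Algebra ℂ R]
    [FiniteDimensional ℂ R] (M : Type v) [AddCommGroup M] [Module ℂ M] [Module R M]
    [IsScalarTower ℂ R M] [IsSimpleModule R M] : FiniteDimensional ℂ M :=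
  have : Module.Finite R M := inferInstance
  Module.Finite.trans R M

variable {R : Type u} [Ring R] [Algebra ℂ R]
  {M : Type v} [AddCommGroup M] [Module ℂ M] [Module R M] [IsScalarTower ℂ R M]
  [IsSimpleModule R M] [FiniteDimensional ℂ M]

/-- Schur's lemma. -/
theorem exists_eq_smul_of_commute (T : M →ₗ[ℂ] M) (hT : ∀ (r : R) (x : M), T (r • x) = r • T x) :
    ∃ c : ℂ, ∀ x, T x = c • x := by
  have := IsSimpleModule.nontrivial R M
  have : SMulCommClass R ℂ M := IsScalarTower.to_smulCommClass'
  obtain ⟨c, hc⟩ := Module.End.exists_eigenvalue T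
  obtain ⟨y, hy⟩ := hc.exists_hasEigenvector
  let T' : M →ₗ[R] M :=
    { toFun := fun x => T x - c • x
      map_add' := fun x y => by rw [map_add, smul_add]; abel
      map_smul' := fun r x => by rw [hT, RingHom.id_apply, smul_sub, smul_comm] }
  refine ⟨c, fun x => ?_⟩
  rcases T'.injective_or_eq_zero with h | h
  · refine (hy.2 (h ?_)).elim
    rw [map_zero]
    exact sub_eq_zero.2 hy.apply_eq_smul
  · exact sub_eq_zero.1 (LinearMap.congr_fun h x)

/-- Burnside's theorem: a finite-dimensional simple module has the double centralizer property. -/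
theorem exists_smul_eq (X : M →ₗ[ℂ] M) : ∃ r : R, ∀ x, X x = r • x := by
  have : SMulCommClass R ℂ M := IsScalarTower.to_smulCommClass'
  -- By Schur the commutant consists of scalars, so any complex-linear map commutes with it and
  -- density on a finite basis applies.
  let X' : Module.End (Module.End R M) M :=
    { toFun := X
      map_add' := X.map_add
      map_smul' := fun g x => by
        obtain ⟨c, hc⟩ := exists_eq_smul_of_commute (R := R) (g.restrictScalars ℂ)
          (fun r x => g.map_smul r x)
        have hc' : ∀ x, g x = c • x := hc
        rw [Module.End.smul_def, hc', map_smul, RingHom.id_apply, Module.End.smul_def, hc'] }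
  classical
  let b := Module.finBasis ℂ M
  obtain ⟨r, hr⟩ := jacobson_density (R := R) X' (Finset.univ.image b)
  refine ⟨r, fun x => ?_⟩
  have h : X = Module.toModuleEnd ℂ (S := R) M r := by
    refine b.ext fun i => ?_
    exact hr (b i) (Finset.mem_image_of_mem _ (Finset.mem_univ i))
  rw [h]
  rfl

end Simple

/-! ### Traces on an endomorphism algebra -/

section EndTrace

variable {V : Type v} [AddCommGroup V] [Module ℂ V] [FiniteDimensional ℂ V]

theorem eq_sum_smulRight (X : Module.End ℂ V) :
    X = ∑ i, ((Module.finBasis ℂ V).coord i).smulRight (X (Module.finBasis ℂ V i)) := by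
  ext x
  conv_lhs => rw [← (Module.finBasis ℂ V).sum_repr x]
  simp only [map_sum, map_smul, LinearMap.sum_apply, LinearMap.smulRight_apply,
    Module.Basis.coord_apply]

/-- Every functional with the trace property is a multiple of the trace. -/
theorem exists_eq_mul_trace (τ : Module.Dual ℂ (Module.End ℂ V))
    (hτ : ∀ X Y, τ (X * Y) = τ (Y * X)) : ∃ κ : ℂ, ∀ X, τ X = κ * LinearMap.trace ℂ V X := by
  rcases subsingleton_or_nontrivial V with h | h
  · refine ⟨0, fun X => ?_⟩
    rw [Subsingleton.elim X 0]
    simp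
  obtain ⟨v, hv⟩ := exists_ne (0 : V)
  obtain ⟨ψ, hψ⟩ := Module.Projective.exists_dual_eq_one ℂ hv
  -- A trace-like functional is determined on rank-one maps by its value at the idempotent
  -- `ψ.smulRight v`, whose trace is 1.
  have key : ∀ σ : Module.Dual ℂ (Module.End ℂ V), (∀ X Y, σ (X * Y) = σ (Y * X)) →
      ∀ (θ : Module.Dual ℂ V) (x : V), σ (θ.smulRight x) = θ x * σ (ψ.smulRight v) := by
    intro σ hσ θ x
    have h1 : (θ.smulRight x : Module.End ℂ V) = ψ.smulRight x * θ.smulRight v := by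
      ext y
      simp [hψ]
    have h2 : (ψ.smulRight v : Module.End ℂ V) * ψ.smulRight v = ψ.smulRight v := by
      ext y
      simp [hψ]
    have h3 : (θ.smulRight v : Module.End ℂ V) * ψ.smulRight x = θ x • ψ.smulRight v := by
      ext y
      simp [smul_smul, mul_comm]
    rw [h1, hσ, h3, map_smul, smul_eq_mul]
  have htr : LinearMap.trace ℂ V (ψ.smulRight v) = 1 := by
    simp [hψ]
  refine ⟨τ (ψ.smulRight v), fun X => ?_⟩
  rw [eq_sum_smulRight X, map_sum, map_sum, Finset.mul_sum]
  refine Finset.sum_congr rfl fun i _ => ?_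
  rw [key τ hτ, key _ (LinearMap.trace_mul_comm ℂ), htr, mul_one, mul_comm]

/-- The two-sided ideal generated by a nonzero endomorphism contains the identity. -/
theorem exists_sum_mul_mul_eq_one {X : Module.End ℂ V} (hX : X ≠ 0) :
    ∃ (n : ℕ) (Y Z : Fin n → Module.End ℂ V), ∑ i, Y i * X * Z i = 1 := by
  obtain ⟨y, hy⟩ : ∃ y, X y ≠ 0 := by
    by_contra! h
    exact hX (LinearMap.ext h)
  obtain ⟨ψ, hψ⟩ := Module.Projective.exists_dual_eq_one ℂ hy
  refine ⟨_, fun i => ψ.smulRight (Module.finBasis ℂ V i),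
    fun i => ((Module.finBasis ℂ V).coord i).smulRight y, ?_⟩
  rw [eq_sum_smulRight (1 : Module.End ℂ V)]
  refine Finset.sum_congr rfl fun i _ => ?_
  ext x
  simp [hψ]

end EndTrace

/-! ### The graded components and the functional `λ` -/

section Graded

variable {m : ℕ} {A : Type u} [Ring A] [Algebra ℂ A] (𝒜 : ZMod m → Submodule ℂ A)
  [GradedAlgebra 𝒜]

theorem gradeProj_of_mem {r : ZMod m} {a : A} (ha : a ∈ 𝒜 r) : (gradeProj 𝒜 r a : A) = a :=
  DirectSum.decompose_of_mem_same 𝒜 ha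

theorem gradeProj_of_mem_of_ne {r s : ZMod m} {a : A} (ha : a ∈ 𝒜 s) (h : s ≠ r) :
    gradeProj 𝒜 r a = 0 :=
  Subtype.ext (DirectSum.decompose_of_mem_ne 𝒜 ha h)

theorem graded_induction {P : A → Prop} (hmem : ∀ r, ∀ a ∈ 𝒜 r, P a)
    (hadd : ∀ a b, P a → P b → P (a + b)) (a : A) : P a := by
  induction a using DirectSum.Decomposition.inductionOn 𝒜 with
  | zero => exact hmem 0 0 (zero_mem _)
  | homogeneous x => exact hmem _ _ x.2
  | add x y hx hy => exact hadd _ _ hx hy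

theorem coe_gradeProj_zero_mul {b : A} (hb : b ∈ 𝒜 0) (a : A) (r : ZMod m) :
    (gradeProj 𝒜 r (b * a) : A) = b * gradeProj 𝒜 r a := by
  induction a using graded_induction 𝒜 with
  | hmem s a ha =>
    have hba : b * a ∈ 𝒜 s := zero_mul_mem ⟨b, hb⟩ ha
    by_cases h : s = r
    · subst h
      rw [gradeProj_of_mem 𝒜 ha, gradeProj_of_mem 𝒜 hba]
    · rw [gradeProj_of_mem_of_ne 𝒜 ha h, gradeProj_of_mem_of_ne 𝒜 hba h]
      simp
  | hadd x y hx hy => simp only [mul_add, map_add, Submodule.coe_add, hx, hy]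

theorem coe_gradeProj_mul_zero {b : A} (hb : b ∈ 𝒜 0) (a : A) (r : ZMod m) :
    (gradeProj 𝒜 r (a * b) : A) = gradeProj 𝒜 r a * b := by
  induction a using graded_induction 𝒜 with
  | hmem s a ha =>
    have hba : a * b ∈ 𝒜 s := mul_zero_mem ⟨b, hb⟩ ha
    by_cases h : s = r
    · subst h
      rw [gradeProj_of_mem 𝒜 ha, gradeProj_of_mem 𝒜 hba]
    · rw [gradeProj_of_mem_of_ne 𝒜 ha h, gradeProj_of_mem_of_ne 𝒜 hba h]
      simp
  | hadd x y hx hy => simp only [add_mul, map_add, Submodule.coe_add, hx, hy]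

theorem pow_mem_graded {r : ZMod m} {a : A} (ha : a ∈ 𝒜 r) (k : ℕ) : a ^ k ∈ 𝒜 (k * r) := by
  simpa using SetLike.pow_mem_graded k ha

variable [StarRing A] [StarModule ℂ A] {𝒜}

namespace FrobeniusStar

theorem eq_zero_of_mul_star (F : FrobeniusStar 𝒜) {a : A} (h : a * star a = 0) : a = 0 := by
  by_contra hne
  have h2 := F.pos a hne
  rw [h] at h2
  simp at h2

theorem eq_zero_of_star_mul (F : FrobeniusStar 𝒜) {a : A} (h : star a * a = 0) : a = 0 := by
  have := F.eq_zero_of_mul_star (a := star a) (by rwa [star_star])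
  simpa using this

theorem star_mem_zero (F : FrobeniusStar 𝒜) {a : A} (ha : a ∈ 𝒜 0) : star a ∈ 𝒜 0 := by
  simpa using F.star_mem 0 a ha

theorem isSemisimpleRing (F : FrobeniusStar 𝒜) [FiniteDimensional ℂ A] : IsSemisimpleRing A :=
  have : IsArtinianRing A := IsArtinianRing.of_finite ℂ A
  isSemisimpleRing_of_proper_involution star star_mul star_star fun _ => F.eq_zero_of_star_mul

theorem isSemisimpleRing_zero (F : FrobeniusStar 𝒜) [FiniteDimensional ℂ A] : IsSemisimpleRing (𝒜 0) :=
  have : IsArtinianRing (𝒜 0) := IsArtinianRing.of_finite ℂ (𝒜 0)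
  isSemisimpleRing_of_proper_involution (fun a => ⟨star (a : A), F.star_mem_zero a.2⟩)
    (fun a b => Subtype.ext (star_mul (a : A) b)) (fun a => Subtype.ext (star_star (a : A)))
    fun _ h => Subtype.ext (F.eq_zero_of_star_mul (congrArg Subtype.val h))

theorem lam_of_mem_zero (F : FrobeniusStar 𝒜) {a : A} (ha : a ∈ 𝒜 0) : F.lam a = F.lam0 ⟨a, ha⟩ :=
  congrArg F.lam0 (Subtype.ext (gradeProj_of_mem 𝒜 ha))

theorem lam_of_mem_of_ne (F : FrobeniusStar 𝒜) {r : ZMod m} {a : A} (ha : a ∈ 𝒜 r) (h : r ≠ 0) : F.lam a = 0 := by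
  have : F.lam a = F.lam0 (gradeProj 𝒜 0 a) := rfl
  rw [this, gradeProj_of_mem_of_ne 𝒜 ha h, map_zero]

theorem lam_gradeProj (F : FrobeniusStar 𝒜) (a : A) : F.lam (gradeProj 𝒜 0 a) = F.lam a :=
  F.lam_of_mem_zero (gradeProj 𝒜 0 a).2

/-- Only degree-0 factors may be cycled: multiplication by `b` preserves degree, which reduces the
claim to the trace property of `lam0`. -/
theorem lam_mul_comm (F : FrobeniusStar 𝒜) {b : A} (hb : b ∈ 𝒜 0) (a : A) : F.lam (b * a) = F.lam (a * b) := by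
  rw [← F.lam_gradeProj (b * a), ← F.lam_gradeProj (a * b), coe_gradeProj_zero_mul 𝒜 hb,
    coe_gradeProj_mul_zero 𝒜 hb, F.lam_of_mem_zero (zero_mul_mem ⟨b, hb⟩ (gradeProj 𝒜 0 a).2),
    F.lam_of_mem_zero (mul_zero_mem ⟨b, hb⟩ (gradeProj 𝒜 0 a).2)]
  exact F.lam0_mul_comm ⟨b, hb⟩ (gradeProj 𝒜 0 a)

theorem phi_apply (F : FrobeniusStar 𝒜) [FiniteDimensional ℂ A] (a x : A) : F.phi a x = F.lam (x * a) := rfl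

/-- An idempotent which commutes with its adjoint is self-adjoint. -/
theorem star_eq_of_idem (F : FrobeniusStar 𝒜) {f : A} (hf : f * f = f) (hc : f * star f = star f * f) : star f = f := by
  have hs : star f * star f = star f := by rw [← star_mul, hf]
  -- Zero norm gives `f = f * star f`, and the right side is self-adjoint.
  have h1 : (f - f * star f) * star (f - f * star f) = 0 := by
    rw [star_sub, star_mul, star_star, sub_mul, mul_sub, mul_sub]
    have e1 : f * (f * star f) = f * star f := by rw [← mul_assoc, hf]
    have e2 : f * star f * star f = f * star f := by rw [mul_assoc, hs]
    have e3 : f * star f * (f * star f) = f * star f := by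
      rw [← mul_assoc, mul_assoc f, ← hc, ← mul_assoc, hf, mul_assoc, hs]
    rw [e1, e2, e3]
    abel
  have h2 : f = f * star f := sub_eq_zero.1 (F.eq_zero_of_mul_star h1)
  have h3 : star f = f * star f := by
    conv_lhs => rw [h2]
    rw [star_mul, star_star]
  rw [h3, ← h2]

end FrobeniusStar

end Graded

/-! ### The induced module -/

section Induced

variable {m : ℕ} {A : Type u} [Ring A] [Algebra ℂ A] {𝒜 : ZMod m → Submodule ℂ A}
  [GradedAlgebra 𝒜] {M : Type v} [AddCommGroup M] [Module ℂ M] [Module (𝒜 0) M]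

theorem mul_smul_mem_tensorGrade {r s : ZMod m} {a : A} (ha : a ∈ 𝒜 r) {t : TensorInd 𝒜 M}
    (ht : t ∈ tensorGrade 𝒜 M s) : a • t ∈ tensorGrade 𝒜 M (r + s) := by
  induction ht using Submodule.span_induction with
  | mem t ht =>
    obtain ⟨b, hb, x, rfl⟩ := ht
    exact Submodule.subset_span ⟨a * b, SetLike.mul_mem_graded ha hb, x, rfl⟩
  | zero => rw [smul_zero]; exact zero_mem _
  | add s t _ _ hs ht => rw [smul_add]; exact add_mem hs ht
  | smul c t _ ht => rw [smul_comm]; exact Submodule.smul_mem _ c ht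

variable (𝒜) in
/-- The class of `a ⊗ x` in the induced module. -/
noncomputable def ind (a : A) (x : M) : Induced 𝒜 M :=
  (nullSocle 𝒜 M).mkQ ((balancedRel 𝒜 M).mkQ (a ⊗ₜ[ℂ] x))

theorem ind_add (a : A) (x y : M) : ind 𝒜 a (x + y) = ind 𝒜 a x + ind 𝒜 a y := by
  simp only [ind, TensorProduct.tmul_add, map_add]

theorem add_ind (a b : A) (x : M) : ind 𝒜 (a + b) x = ind 𝒜 a x + ind 𝒜 b x := by
  simp only [ind, TensorProduct.add_tmul, map_add]

theorem ind_smul (c : ℂ) (a : A) (x : M) : ind 𝒜 a (c • x) = c • ind 𝒜 a x := by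
  simp only [ind, TensorProduct.tmul_smul]
  rfl

theorem smul_ind (c : ℂ) (a : A) (x : M) : ind 𝒜 (c • a) x = c • ind 𝒜 a x := by
  rw [← ind_smul]
  simp only [ind, TensorProduct.smul_tmul]

theorem mul_ind (a b : A) (x : M) : a • ind 𝒜 b x = ind 𝒜 (a * b) x := rfl

theorem ind_zero_smul (a : A) (b : 𝒜 0) (x : M) : ind 𝒜 a (b • x) = ind 𝒜 (a * b) x := by
  symm
  refine congrArg (nullSocle 𝒜 M).mkQ ((Submodule.Quotient.eq _).2 ?_)
  exact Submodule.subset_span ⟨a, b, x, rfl⟩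

theorem ind_mem_conjugate {r : ZMod m} {a : A} (ha : a ∈ 𝒜 r) (x : M) :
    ind 𝒜 a x ∈ conjugate 𝒜 M r :=
  ⟨_, Submodule.subset_span ⟨a, ha, x, rfl⟩, rfl⟩

theorem conjugate_eq_span (r : ZMod m) :
    conjugate 𝒜 M r = Submodule.span ℂ {t | ∃ a ∈ 𝒜 r, ∃ x : M, t = ind 𝒜 a x} := by
  rw [conjugate, tensorGrade, Submodule.map_span]
  congr 1
  ext t
  constructor
  · rintro ⟨_, ⟨a, ha, x, rfl⟩, rfl⟩
    exact ⟨a, ha, x, rfl⟩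
  · rintro ⟨a, ha, x, rfl⟩
    exact ⟨_, ⟨a, ha, x, rfl⟩, rfl⟩

variable [IsScalarTower ℂ (𝒜 0) M]

/-- The map `A ⊗ M → A`, `a ⊗ x ↦ a g(x)`, of an `𝒜 0`-linear map `g : M → 𝒜 0`. -/
noncomputable def tensorEval (g : M →ₗ[𝒜 0] 𝒜 0) : TensorInd 𝒜 M →ₗ[A] A :=
  (balancedRel 𝒜 M).liftQ
    (TensorProduct.AlgebraTensorModule.lift
      (LinearMap.mk₂' A ℂ (fun (a : A) (x : M) => a * (g x : A))
        (fun a b x => add_mul _ _ _) (fun c a x => mul_assoc _ _ _)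
        (fun a x y => by rw [map_add, Submodule.coe_add, mul_add])
        (fun c a x => by
          have : g (c • x) = c • g x := (g.restrictScalars ℂ).map_smul c x
          rw [this, Submodule.coe_smul, mul_smul_comm])))
    (by
      rw [balancedRel, Submodule.span_le]
      rintro _ ⟨a, b, x, rfl⟩
      simp [mul_assoc])

theorem tensorEval_mk (g : M →ₗ[𝒜 0] 𝒜 0) (a : A) (x : M) :
    tensorEval g ((balancedRel 𝒜 M).mkQ (a ⊗ₜ[ℂ] x)) = a * (g x : A) := rfl

theorem tensorEval_mem (g : M →ₗ[𝒜 0] 𝒜 0) {r : ZMod m} {t : TensorInd 𝒜 M}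
    (ht : t ∈ tensorGrade 𝒜 M r) : tensorEval g t ∈ 𝒜 r := by
  induction ht using Submodule.span_induction with
  | mem t ht =>
    obtain ⟨a, ha, x, rfl⟩ := ht
    rw [tensorEval_mk]
    exact mul_zero_mem (g x) ha
  | zero => rw [map_zero]; exact zero_mem _
  | add s t _ _ hs ht => rw [map_add]; exact add_mem hs ht
  | smul c t _ ht =>
    rw [← algebraMap_smul A c t, map_smul, algebraMap_smul]
    exact Submodule.smul_mem _ c ht

variable [StarRing A] [StarModule ℂ A]

/-- If `t` is homogeneous in a null submodule and evaluates to `y`, then `star y • t` is in its zero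
component, hence 0; evaluating gives `star y * y = 0`. -/
theorem FrobeniusStar.nullSocle_le_ker (F : FrobeniusStar 𝒜) (g : M →ₗ[𝒜 0] 𝒜 0) :
    nullSocle 𝒜 M ≤ LinearMap.ker (tensorEval g) := by
  refine sSup_le ?_
  rintro U ⟨hU, hU0⟩ t ht
  have ht' : t ∈ U.restrictScalars ℂ := ht
  rw [hU] at ht'
  refine Submodule.iSup_induction _ (motive := fun t => tensorEval g t = 0) ht' ?_ (map_zero _)
    fun s t hs ht => by rw [map_add, hs, ht, add_zero]
  rintro r t ⟨h1, h2⟩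
  set y := tensorEval g t with hy
  have h3 := F.star_mem r y (tensorEval_mem g h2)
  have h4 : star y • t ∈ U.restrictScalars ℂ ⊓ tensorGrade 𝒜 M 0 := by
    refine ⟨U.smul_mem _ h1, ?_⟩
    simpa using mul_smul_mem_tensorGrade h3 h2
  rw [hU0, Submodule.mem_bot] at h4
  apply F.eq_zero_of_star_mul
  rw [hy, ← smul_eq_mul (star _), ← map_smul, ← hy, h4, map_zero]

/-- Converts vanishing in the induced module into an equation in `A`: evaluation yields `a * g x =
0`, and such `g x` sum to `f`. -/
theorem FrobeniusStar.mul_eq_zero_of_ind (F : FrobeniusStar 𝒜) {f : 𝒜 0} (hf : IsBlock M f)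
    {a : A} (ha : ∀ x : M, ind 𝒜 a x = 0) : a * f = 0 := by
  refine hf.mul_eq_zero (𝒜 0).subtype.toAddMonoidHom a fun g x => ?_
  have h := F.nullSocle_le_ker g ((Submodule.Quotient.mk_eq_zero _).1 (ha x))
  exact h

end Induced

/-! ### Schur's lemma and traces for simple `𝒜 0`-modules -/

section ZeroAction

variable {m : ℕ} {A : Type u} [Ring A] [Algebra ℂ A] {𝒜 : ZMod m → Submodule ℂ A}
  [GradedAlgebra 𝒜]

variable (𝒜) in
/-- The action of `𝒜 0` on an `𝒜 0`-module, as an algebra homomorphism. -/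
noncomputable def zeroAction (M : Type v) [AddCommGroup M] [Module ℂ M] [Module (𝒜 0) M]
    [IsScalarTower ℂ (𝒜 0) M] : 𝒜 0 →ₐ[ℂ] Module.End ℂ M :=
  haveI : SMulCommClass (𝒜 0) ℂ M := IsScalarTower.to_smulCommClass'
  Algebra.lsmul ℂ ℂ M

variable {M : Type v} [AddCommGroup M] [Module ℂ M] [Module (𝒜 0) M] [IsScalarTower ℂ (𝒜 0) M]

@[simp]
theorem zeroAction_apply (a : 𝒜 0) (x : M) : zeroAction 𝒜 M a x = a • x := rfl

variable [FiniteDimensional ℂ A] [IsSimpleModule (𝒜 0) M]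

/-- The centre of a block is `ℂ f`: `b` acts on `M` by a Schur scalar, and an element acting as zero
is killed by `f`. -/
theorem IsBlock.exists_eq_smul {f : 𝒜 0} (hf : IsBlock M f) {b : A} (hb : b ∈ 𝒜 0)
    (hcomm : ∀ a ∈ 𝒜 0, a * b = b * a) (hbf : b * f = b) : ∃ c : ℂ, b = c • (f : A) := by
  have := finiteDimensional_of_isSimpleModule (𝒜 0) M
  obtain ⟨c, hc⟩ := exists_eq_smul_of_commute (R := 𝒜 0) (zeroAction 𝒜 M ⟨b, hb⟩) (fun r x => by
    rw [zeroAction_apply, zeroAction_apply, smul_smul, smul_smul]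
    congr 1
    exact Subtype.ext (hcomm r r.2).symm)
  refine ⟨c, ?_⟩
  have h : ((⟨b, hb⟩ : 𝒜 0) - c • (1 : 𝒜 0)) * f = 0 := by
    refine hf.mul_eq_zero_of_smul fun x => ?_
    rw [sub_smul, smul_assoc, one_smul, ← hc, zeroAction_apply, sub_self]
  have h2 : b * (f : A) - c • (f : A) = 0 := by
    rw [sub_mul, smul_mul_assoc, one_mul] at h
    exact congrArg Subtype.val h
  rw [← hbf]
  exact sub_eq_zero.1 h2

theorem zeroAction_surjective : Function.Surjective (zeroAction 𝒜 M) := by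
  have := finiteDimensional_of_isSimpleModule (𝒜 0) M
  intro X
  obtain ⟨r, hr⟩ := exists_smul_eq (R := 𝒜 0) X
  exact ⟨r, LinearMap.ext fun x => (hr x).symm⟩

theorem IsBlock.mul_eq_mul {f : 𝒜 0} (hf : IsBlock M f) {a b : 𝒜 0}
    (h : zeroAction 𝒜 M a = zeroAction 𝒜 M b) : a * f = b * f := by
  rw [← sub_eq_zero, ← sub_mul]
  refine hf.mul_eq_zero_of_smul fun x => ?_
  rw [sub_smul, sub_eq_zero]
  exact LinearMap.congr_fun h x

variable [StarRing A] [StarModule ℂ A]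

/-- The functional `b ↦ λ(b f)` factors through `End M` and keeps the trace property. The constant
is nonzero because `λ(f) = λ(f * star f)`. -/
theorem FrobeniusStar.exists_lam_mul_eq (F : FrobeniusStar 𝒜) {f : 𝒜 0} (hf : IsBlock M f) :
    ∃ κ : ℂ, κ ≠ 0 ∧ ∀ b : 𝒜 0,
      F.lam ((b : A) * f) = κ * LinearMap.trace ℂ M (zeroAction 𝒜 M b) := by
  have := finiteDimensional_of_isSimpleModule (𝒜 0) M
  have := IsSimpleModule.nontrivial (𝒜 0) M
  obtain ⟨s, hs⟩ := (zeroAction 𝒜 M).toLinearMap.exists_rightInverse_of_surjective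
    (LinearMap.range_eq_top.2 zeroAction_surjective)
  have hs' : ∀ X, zeroAction 𝒜 M (s X) = X := fun X => LinearMap.congr_fun hs X
  let ℓ : Module.Dual ℂ (𝒜 0) := F.lam ∘ₗ (𝒜 0).subtype ∘ₗ LinearMap.mulRight ℂ f
  have hℓ : ∀ b : 𝒜 0, ℓ b = F.lam ((b : A) * f) := fun b => rfl
  have hker : ∀ a b, zeroAction 𝒜 M a = zeroAction 𝒜 M b → ℓ a = ℓ b := fun a b h => by
    rw [hℓ, hℓ]
    exact congrArg (fun x : 𝒜 0 => F.lam (x : A)) (hf.mul_eq_mul h)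
  -- The linear section `s` need not be multiplicative; `hker` absorbs the discrepancy.
  obtain ⟨κ, hκ⟩ := exists_eq_mul_trace (ℓ ∘ₗ s) (fun X Y => by
    have h1 : ∀ X Y, (ℓ ∘ₗ s) (X * Y) = ℓ (s X * s Y) := fun X Y => by
      refine hker _ _ ?_
      rw [map_mul (zeroAction 𝒜 M), hs', hs', hs']
    have hc : ∀ x, (f : A) * (x : 𝒜 0) = x * f := fun x => congrArg Subtype.val (hf.comm x)
    rw [h1, h1, hℓ, hℓ, SetLike.GradeZero.coe_mul, mul_assoc, F.lam_mul_comm (s X).2, mul_assoc,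
      hc, ← mul_assoc, SetLike.GradeZero.coe_mul])
  have hκ' : ∀ b : 𝒜 0, F.lam ((b : A) * f) = κ * LinearMap.trace ℂ M (zeroAction 𝒜 M b) :=
    fun b => by rw [← hκ, ← hℓ]; exact hker _ _ (hs' _).symm
  refine ⟨κ, ?_, hκ'⟩
  rintro rfl
  have hidem : (f : A) * f = f := congrArg Subtype.val hf.idem
  have hstar : star (f : A) = f := F.star_eq_of_idem hidem
    (congrArg Subtype.val (hf.comm ⟨star (f : A), F.star_mem_zero f.2⟩))
  refine hf.ne_zero (Subtype.ext (by_contra fun h0 => ?_))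
  have h1 := F.pos f h0
  rw [hstar, hidem] at h1
  have h2 := hκ' 1
  rw [SetLike.GradeZero.coe_one, one_mul, zero_mul] at h2
  have h3 : extendByZero 𝒜 0 F.lam0 (f : A) = 0 := h2
  rw [h3] at h1
  simp at h1

end ZeroAction

/-! ### Twists -/

section Twist

variable {m : ℕ} {A : Type u} [Ring A] [Algebra ℂ A]

/-- `f` is an idempotent of `𝒜 0`, and `u` is an `m`-th root of `f` in `𝒜 1` which commutes
with `𝒜 0`. -/
structure IsTwist (𝒜 : ZMod m → Submodule ℂ A) (f u : A) : Prop where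
  mem_zero : f ∈ 𝒜 0
  mem_one : u ∈ 𝒜 1
  comm_zero : ∀ a ∈ 𝒜 0, a * u = u * a
  pow_eq : u ^ m = f
  mul_eq : f * u = u

namespace IsTwist

variable [NeZero m] {𝒜 : ZMod m → Submodule ℂ A} [GradedAlgebra 𝒜] {f u : A}

theorem comm_idem (T : IsTwist 𝒜 f u) {a : A} (ha : a ∈ 𝒜 0) : a * f = f * a := by
  have h : Commute a u := T.comm_zero a ha
  rw [← T.pow_eq]
  exact (h.pow_right m).eq

theorem idem (T : IsTwist 𝒜 f u) : f * f = f := by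
  obtain ⟨k, hk⟩ := Nat.exists_eq_succ_of_ne_zero (NeZero.ne m)
  have h := T.pow_eq
  rw [hk, pow_succ'] at h
  calc f * f = f * u * u ^ k := by rw [mul_assoc, h]
    _ = f := by rw [T.mul_eq, h]

theorem idem_mul_pow_mul (T : IsTwist 𝒜 f u) (k : ℕ) : f * u ^ (m * k) = f := by
  rw [pow_mul, T.pow_eq]
  induction k with
  | zero => simp
  | succ k ih => rw [pow_succ, ← mul_assoc, ih, T.idem]

theorem idem_mul_pow_of_dvd (T : IsTwist 𝒜 f u) {k : ℕ} (h : m ∣ k) : f * u ^ k = f := by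
  obtain ⟨j, rfl⟩ := h
  exact T.idem_mul_pow_mul j

theorem pow_mem (T : IsTwist 𝒜 f u) (k : ℕ) : u ^ k ∈ 𝒜 k := by
  simpa using pow_mem_graded 𝒜 T.mem_one k

/-- The power of `u` which moves degree `r` to degree zero. -/
theorem mul_pow_mem (T : IsTwist 𝒜 f u) {r : ZMod m} {a : A} (ha : a ∈ 𝒜 r) :
    a * f * u ^ (-r).val ∈ 𝒜 0 := by
  have h := SetLike.mul_mem_graded (SetLike.mul_mem_graded ha T.mem_zero) (T.pow_mem (-r).val)
  simpa using h

theorem mul_pow_mul_pow (T : IsTwist 𝒜 f u) (r : ZMod m) (a : A) :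
    a * f * u ^ (-r).val * u ^ r.val = a * f := by
  rw [mul_assoc, ← pow_add, mul_assoc, T.idem_mul_pow_of_dvd]
  rw [← ZMod.natCast_eq_zero_iff]
  simp

theorem exists_eq_mul_pow (T : IsTwist 𝒜 f u) {r : ZMod m} {a : A} (ha : a ∈ 𝒜 r) :
    ∃ b ∈ 𝒜 0, a * f = b * f * u ^ r.val := by
  refine ⟨_, T.mul_pow_mem ha, ?_⟩
  have hc : Commute u f := (T.comm_zero f T.mem_zero).symm
  rw [mul_assoc _ _ f, (hc.pow_left _).eq, ← mul_assoc, mul_assoc a f f, T.idem,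
    T.mul_pow_mul_pow]

theorem ne_zero (T : IsTwist 𝒜 f u) (hf : f ≠ 0) : u ≠ 0 := by
  rintro rfl
  apply hf
  rw [← T.pow_eq, zero_pow (NeZero.ne m)]

theorem commute_pow (T : IsTwist 𝒜 f u) {a : A} (ha : a ∈ 𝒜 0) (k : ℕ) : Commute a (u ^ k) :=
  Commute.pow_right (T.comm_zero a ha) k

section Star

variable [StarRing A] [StarModule ℂ A]

theorem star_idem (T : IsTwist 𝒜 f u) (F : FrobeniusStar 𝒜) : star f = f :=
  F.star_eq_of_idem T.idem (T.comm_idem (F.star_mem_zero T.mem_zero)).symm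

/-- Writing `a f = b f u ^ r` with `b` of degree 0 gives `f a f = a f`. The adjoint of this for
`star a` is `f a f = f a`. -/
theorem comm_idem_all (T : IsTwist 𝒜 f u) (F : FrobeniusStar 𝒜) (a : A) : f * a = a * f := by
  have h1 : ∀ r, ∀ a ∈ 𝒜 r, f * a * f = a * f := by
    intro r a ha
    obtain ⟨b, hb, hab⟩ := T.exists_eq_mul_pow ha
    rw [mul_assoc, hab, T.comm_idem hb, ← mul_assoc, ← mul_assoc, T.idem]
  induction a using graded_induction 𝒜 with
  | hmem r a ha =>
    have h2 := congrArg star (h1 _ _ (F.star_mem r a ha))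
    simp only [star_mul, star_star, T.star_idem F] at h2
    rw [← h2, ← mul_assoc, h1 r a ha]
  | hadd x y hx hy => rw [mul_add, add_mul, hx, hy]

theorem comm (T : IsTwist 𝒜 f u) (F : FrobeniusStar 𝒜) (a : A) : u * a = a * u := by
  induction a using graded_induction 𝒜 with
  | hmem r a ha =>
    obtain ⟨b, hb, hab⟩ := T.exists_eq_mul_pow ha
    have hbf : b * f ∈ 𝒜 0 := mul_zero_mem ⟨f, T.mem_zero⟩ hb
    have hu : Commute u (b * f * u ^ r.val) :=
      Commute.mul_right (T.comm_zero _ hbf).symm (Commute.self_pow u _)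
    calc u * a = u * (a * f) := by
          rw [← T.comm_idem_all F, ← mul_assoc, ← T.comm_zero f T.mem_zero, T.mul_eq]
      _ = a * f * u := by rw [hab, hu.eq]
      _ = a * u := by rw [mul_assoc, T.mul_eq]
  | hadd x y hx hy => rw [mul_add, add_mul, hx, hy]

end Star

variable (m) in
/-- `m` times the central idempotent of `A` on which `u` acts as the identity. -/
noncomputable def _root_.TwistedFrobenius.cyclicSum (f u : A) : A :=
  ∑ k ∈ Finset.range m, f * u ^ k

/-- Multiplication by `u` shifts the sum cyclically, as `f * u ^ m = f`. -/
theorem mul_cyclicSum (T : IsTwist 𝒜 f u) : u * cyclicSum m f u = cyclicSum m f u := by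
  have h1 : u * cyclicSum m f u = ∑ k ∈ Finset.range m, f * u ^ (k + 1) := by
    rw [cyclicSum, Finset.mul_sum]
    refine Finset.sum_congr rfl fun k _ => ?_
    rw [← mul_assoc, ← T.comm_zero f T.mem_zero, mul_assoc, pow_succ']
  have h2 := Finset.sum_range_succ (fun k => f * u ^ k) m
  rw [Finset.sum_range_succ', T.pow_eq, T.idem, pow_zero, mul_one] at h2
  rw [h1]
  exact add_right_cancel h2

theorem pow_mul_cyclicSum (T : IsTwist 𝒜 f u) (k : ℕ) :
    u ^ k * cyclicSum m f u = cyclicSum m f u := by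
  induction k with
  | zero => simp
  | succ k ih => rw [pow_succ, mul_assoc, T.mul_cyclicSum, ih]

theorem idem_mul_cyclicSum (T : IsTwist 𝒜 f u) : f * cyclicSum m f u = cyclicSum m f u := by
  have h := T.pow_mul_cyclicSum m
  rwa [T.pow_eq] at h

theorem cyclicSum_mul_cyclicSum (T : IsTwist 𝒜 f u) :
    cyclicSum m f u * cyclicSum m f u = (m : ℂ) • cyclicSum m f u := by
  have h : ∀ k ∈ Finset.range m, f * u ^ k * cyclicSum m f u = cyclicSum m f u := fun k _ => by
    rw [mul_assoc, T.pow_mul_cyclicSum, T.idem_mul_cyclicSum]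
  have h2 := Finset.sum_congr rfl h
  rw [← Finset.sum_mul] at h2
  refine h2.trans ?_
  rw [Finset.sum_const, Finset.card_range, Nat.cast_smul_eq_nsmul]

theorem gradeProj_mul_cyclicSum (T : IsTwist 𝒜 f u) {r : ZMod m} {a : A} (ha : a ∈ 𝒜 r) :
    (gradeProj 𝒜 0 (a * cyclicSum m f u) : A) = a * f * u ^ (-r).val := by
  rw [cyclicSum, Finset.mul_sum, map_sum, Submodule.coe_sum,
    Finset.sum_eq_single (-r).val]
  · rw [← mul_assoc, gradeProj_of_mem 𝒜 (T.mul_pow_mem ha)]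
  · intro k hk hne
    have h : a * (f * u ^ k) ∈ 𝒜 (r + (0 + k)) :=
      SetLike.mul_mem_graded ha (SetLike.mul_mem_graded T.mem_zero (T.pow_mem k))
    rw [gradeProj_of_mem_of_ne 𝒜 h, Submodule.coe_zero]
    intro h0
    apply hne
    have : (k : ZMod m) = -r := by
      rw [zero_add] at h0
      exact (neg_eq_of_add_eq_zero_right h0).symm
    rw [← this, ZMod.val_natCast_of_lt (Finset.mem_range.1 hk)]
  · intro h
    exact (h (Finset.mem_range.2 (ZMod.val_lt _))).elim

theorem gradeProj_cyclicSum (T : IsTwist 𝒜 f u) : (gradeProj 𝒜 0 (cyclicSum m f u) : A) = f := by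
  have h := T.gradeProj_mul_cyclicSum (SetLike.GradedOne.one_mem (A := 𝒜))
  simpa using h

/-- For homogeneous `a` the projection is `a f` times a power of `u`, which `P` absorbs. Thus modulo
`P` every element may be replaced by one of degree 0. -/
theorem gradeProj_mul_cyclicSum_mul (T : IsTwist 𝒜 f u) (a : A) :
    gradeProj 𝒜 0 (a * cyclicSum m f u) * cyclicSum m f u = a * cyclicSum m f u := by
  induction a using graded_induction 𝒜 with
  | hmem r a ha =>
    rw [T.gradeProj_mul_cyclicSum ha, mul_assoc, T.pow_mul_cyclicSum, mul_assoc,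
      T.idem_mul_cyclicSum]
  | hadd x y hx hy => rw [add_mul, map_add, Submodule.coe_add, add_mul, hx, hy]

variable [StarRing A] [StarModule ℂ A]

theorem comm_cyclicSum (T : IsTwist 𝒜 f u) (F : FrobeniusStar 𝒜) (a : A) :
    cyclicSum m f u * a = a * cyclicSum m f u := by
  have h : Commute (cyclicSum m f u) a :=
    Commute.sum_left _ _ _ fun k _ =>
      Commute.mul_left (T.comm_idem_all F a) (Commute.pow_left (T.comm F a) k)
  exact h.eq

end IsTwist

end Twist

/-! ### Twists and invariant simple modules -/

section Invariant

variable {m : ℕ} [NeZero m] {A : Type u} [Ring A] [Algebra ℂ A] [FiniteDimensional ℂ A]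
  {𝒜 : ZMod m → Submodule ℂ A} [GradedAlgebra 𝒜]
  {M : Type v} [AddCommGroup M] [Module ℂ M] [Module (𝒜 0) M] [IsScalarTower ℂ (𝒜 0) M]
  [IsSimpleModule (𝒜 0) M] [StarRing A] [StarModule ℂ A]

theorem FrobeniusStar.comm_star (F : FrobeniusStar 𝒜) {v : A} (hcomm : ∀ a ∈ 𝒜 0, a * v = v * a) :
    ∀ a ∈ 𝒜 0, a * star v = star v * a := by
  intro a ha
  have h := congrArg star (hcomm _ (F.star_mem_zero ha))
  simp only [star_mul, star_star] at h
  exact h.symm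

theorem IsBlock.coe_idem {f : 𝒜 0} (hf : IsBlock M f) : (f : A) * f = f :=
  congrArg Subtype.val hf.idem

theorem IsBlock.coe_comm {f : 𝒜 0} (hf : IsBlock M f) {a : A} (ha : a ∈ 𝒜 0) :
    (f : A) * a = a * f :=
  congrArg Subtype.val (hf.comm ⟨a, ha⟩)

theorem IsBlock.star_eq (F : FrobeniusStar 𝒜) {f : 𝒜 0} (hf : IsBlock M f) :
    star (f : A) = f :=
  F.star_eq_of_idem hf.coe_idem (hf.coe_comm (F.star_mem_zero f.2))

/-- Both `star v * v` and `v ^ m` are central in the block, hence multiples of `f`. The first is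
nonzero by properness, which keeps all powers of `v` nonzero; dividing by an `m`-th root of the
second scalar normalizes `v`. -/
theorem IsBlock.exists_isTwist (F : FrobeniusStar 𝒜) {f : 𝒜 0} (hf : IsBlock M f) {v : A}
    (hv : v ∈ 𝒜 1) (hcomm : ∀ a ∈ 𝒜 0, a * v = v * a) (hvf : v * f = v) (hv0 : v ≠ 0) :
    ∃ u, IsTwist 𝒜 (f : A) u := by
  have hfv : (f : A) * v = v := by rw [hcomm f f.2, hvf]
  have hcomm' := F.comm_star hcomm
  obtain ⟨c, hc⟩ : ∃ c : ℂ, star v * v = c • (f : A) := by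
    refine hf.exists_eq_smul ?_ (fun a ha => ?_) (by rw [mul_assoc, hvf])
    · simpa using SetLike.mul_mem_graded (F.star_mem 1 v hv) hv
    · rw [← mul_assoc, hcomm' a ha, mul_assoc, hcomm a ha, mul_assoc]
  have hc0 : c ≠ 0 := by
    rintro rfl
    rw [zero_smul] at hc
    exact hv0 (F.eq_zero_of_star_mul hc)
  obtain ⟨n, hn⟩ := Nat.exists_eq_succ_of_ne_zero (NeZero.ne m)
  obtain ⟨d, hd⟩ : ∃ d : ℂ, v ^ m = d • (f : A) := by
    refine hf.exists_eq_smul ?_ (fun a ha => ?_) ?_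
    · simpa using pow_mem_graded 𝒜 hv m
    · exact Commute.pow_right (hcomm a ha) m
    · have hvm : v ^ m = v ^ n * v := by rw [← pow_succ]; exact congrArg (v ^ ·) hn
      rw [hvm, mul_assoc, hvf]
  have hpow : ∀ k, v ^ (k + 1) ≠ 0 := by
    intro k
    induction k with
    | zero => simpa using hv0
    | succ k ih =>
      intro h
      apply ih
      have h1 : star v * v ^ (k + 1 + 1) = c • v ^ (k + 1) := by
        rw [pow_succ' v (k + 1), ← mul_assoc, hc, smul_mul_assoc, pow_succ', ← mul_assoc, hfv]
      rw [h, mul_zero] at h1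
      exact (_root_.smul_eq_zero.1 h1.symm).resolve_left hc0
  have hd0 : d ≠ 0 := by
    rintro rfl
    rw [zero_smul, hn] at hd
    exact hpow n hd
  obtain ⟨t, ht⟩ := IsAlgClosed.exists_pow_nat_eq d (NeZero.pos m)
  refine ⟨t⁻¹ • v, f.2, Submodule.smul_mem _ _ hv, fun a ha => ?_, ?_, ?_⟩
  · rw [mul_smul_comm, hcomm a ha, smul_mul_assoc]
  · rw [smul_pow, hd, smul_smul, inv_pow, ht, inv_mul_cancel₀ hd0, one_smul]
  · rw [mul_smul_comm, hfv]

theorem FrobeniusStar.lam_mul_star_self (F : FrobeniusStar 𝒜) (a : A) :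
    F.lam (a * star a) = ((F.lam (a * star a)).re : ℂ) :=
  (Complex.conj_eq_iff_re.1 (F.hermitian a a).symm).symm

/-- Schur gives `u * star u = c • f`, and the `m`-th power gives `c ^ m = 1`. Since `c` is a
quotient of two positive norms, `c = 1`. -/
theorem IsTwist.mul_star_self (F : FrobeniusStar 𝒜) {f : 𝒜 0} (hf : IsBlock M f) {u : A}
    (T : IsTwist 𝒜 (f : A) u) : u * star u = f := by
  have := IsSimpleModule.nontrivial (𝒜 0) M
  have hf0 : (f : A) ≠ 0 := fun h => hf.ne_zero (Subtype.ext h)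
  have hcomm' := F.comm_star T.comm_zero
  have hsf : star u * f = star u := by
    have h := congrArg star T.mul_eq
    rwa [star_mul, hf.star_eq F] at h
  obtain ⟨c, hc⟩ : ∃ c : ℂ, u * star u = c • (f : A) := by
    refine hf.exists_eq_smul ?_ (fun a ha => ?_) (by rw [mul_assoc, hsf])
    · simpa using SetLike.mul_mem_graded T.mem_one (F.star_mem 1 u T.mem_one)
    · rw [← mul_assoc, T.comm_zero a ha, mul_assoc, hcomm' a ha, mul_assoc]
  have hcm : c ^ m = 1 := by
    have h1 : (u * star u) ^ m = f := by
      have hcu : Commute u (star u) := T.comm F (star u)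
      rw [hcu.mul_pow, ← star_pow, T.pow_eq, hf.star_eq F, hf.coe_idem]
    have h2 : (f : A) ^ m = f := by
      have hi : IsIdempotentElem (f : A) := hf.coe_idem
      exact hi.pow_eq (NeZero.ne m)
    rw [hc, smul_pow, h2, ← sub_eq_zero] at h1
    have h3 : (c ^ m - 1) • (f : A) = 0 := by rw [sub_smul, one_smul, h1]
    exact sub_eq_zero.1 ((_root_.smul_eq_zero.1 h3).resolve_right hf0)
  have hxpos := F.pos f hf0
  have hzpos := F.pos u (T.ne_zero hf0)
  have hx := F.lam_mul_star_self (f : A)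
  have hz := F.lam_mul_star_self u
  change 0 < (F.lam ((f : A) * star (f : A))).re at hxpos
  change 0 < (F.lam (u * star u)).re at hzpos
  rw [hf.star_eq F, hf.coe_idem] at hx hxpos
  set x := (F.lam (f : A)).re
  set z := (F.lam (u * star u)).re
  have hzx : (z : ℂ) = c * x := by rw [← hz, hc, map_smul, smul_eq_mul, hx]
  have hcz : c = ((z / x : ℝ) : ℂ) := by
    rw [Complex.ofReal_div, hzx, mul_div_cancel_right₀]
    exact_mod_cast hxpos.ne'
  have hr : (z / x) ^ m = 1 := by
    rw [hcz] at hcm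
    exact_mod_cast hcm
  have hr1 : z / x = 1 := (pow_eq_one_iff_of_nonneg (by positivity) (NeZero.ne m)).1 hr
  rw [hc, hcz, hr1, Complex.ofReal_one, one_smul]

theorem IsTwist.mul_star_self_pow (F : FrobeniusStar 𝒜) {f : 𝒜 0} (hf : IsBlock M f) {u : A}
    (T : IsTwist 𝒜 (f : A) u) (k : ℕ) : (f * u ^ k) * star (f * u ^ k) = f := by
  have hcu : Commute u (star u) := T.comm F (star u)
  have hc : Commute ((f : A) * star u ^ k) (f : A) := (T.comm_idem_all F _).symm
  rw [star_mul, star_pow, hf.star_eq F, mul_assoc, ← mul_assoc (u ^ k), ← hcu.mul_pow,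
    T.mul_star_self F hf, ← pow_succ, ← pow_succ']
  have hi : IsIdempotentElem (f : A) := hf.coe_idem
  exact hi.pow_eq (Nat.succ_ne_zero _)

theorem IsBlock.exists_isTwist_of_isInvariant (F : FrobeniusStar 𝒜) {f : 𝒜 0} (hf : IsBlock M f)
    (hM : IsInvariant 𝒜 M) : ∃ u, IsTwist 𝒜 (f : A) u := by
  have := IsSimpleModule.nontrivial (𝒜 0) M
  have := finiteDimensional_of_isSimpleModule (𝒜 0) M
  obtain ⟨e, he⟩ := hM 1
  -- Only invariance in degree 1 is used: it turns `𝒜 1` into operators on `M`, compatibly with `𝒜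
  -- 0` on both sides.
  let Φ : 𝒜 1 →ₗ[ℂ] Module.End ℂ M :=
    LinearMap.mk₂ ℂ (fun a x => e ⟨ind 𝒜 (a : A) x, ind_mem_conjugate a.2 x⟩)
      (fun a b x => by rw [← map_add]; exact congrArg e (Subtype.ext (add_ind _ _ _)))
      (fun c a x => by rw [← map_smul]; exact congrArg e (Subtype.ext (smul_ind _ _ _)))
      (fun a x y => by rw [← map_add]; exact congrArg e (Subtype.ext (ind_add _ _ _)))
      (fun c a x => by rw [← map_smul]; exact congrArg e (Subtype.ext (ind_smul _ _ _)))
  have hΦl : ∀ (b : 𝒜 0) (a : 𝒜 1),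
      Φ ⟨b * a, zero_mul_mem b a.2⟩ = zeroAction 𝒜 M b * Φ a := by
    intro b a
    ext x
    exact he b ⟨ind 𝒜 (a : A) x, ind_mem_conjugate a.2 x⟩
  have hΦr : ∀ (b : 𝒜 0) (a : 𝒜 1),
      Φ ⟨a * b, mul_zero_mem b a.2⟩ = Φ a * zeroAction 𝒜 M b := by
    intro b a
    ext x
    exact congrArg e (Subtype.ext (ind_zero_smul _ _ _).symm)
  have hker : ∀ a : 𝒜 1, Φ a = 0 → (a : A) * f = 0 := by
    intro a ha
    refine F.mul_eq_zero_of_ind hf fun x => ?_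
    have h := LinearMap.congr_fun ha x
    exact congrArg Subtype.val (e.map_eq_zero_iff.1 h)
  obtain ⟨a, ha⟩ : ∃ a, Φ a ≠ 0 := by
    by_contra! h
    obtain ⟨x, hx⟩ := exists_ne (0 : M)
    have hbot : conjugate 𝒜 M 1 ≤ ⊥ := by
      rw [conjugate_eq_span, Submodule.span_le]
      rintro _ ⟨a, ha, x, rfl⟩
      exact congrArg Subtype.val (e.map_eq_zero_iff.1 (LinearMap.congr_fun (h ⟨a, ha⟩) x))
    have h0 : e.symm x = 0 := Subtype.ext ((Submodule.mem_bot ℂ).1 (hbot (e.symm x).2))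
    exact hx (e.symm.map_eq_zero_iff.1 h0)
  -- The image of `Φ` is a nonzero two-sided ideal of `End M`, so it contains 1. A preimage `u`
  -- commutes with `𝒜 0` modulo the kernel of `Φ`, which `f` kills.
  obtain ⟨n, Y, Z, hYZ⟩ := exists_sum_mul_mul_eq_one ha
  choose b hb using fun i => zeroAction_surjective (𝒜 := 𝒜) (Y i)
  choose c hc using fun i => zeroAction_surjective (𝒜 := 𝒜) (Z i)
  let u : 𝒜 1 := ∑ i, ⟨b i * a * c i, mul_zero_mem (c i) (zero_mul_mem (b i) a.2)⟩
  have hu : Φ u = 1 := by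
    rw [map_sum, ← hYZ]
    refine Finset.sum_congr rfl fun i _ => ?_
    rw [hΦr (c i) ⟨b i * a, zero_mul_mem (b i) a.2⟩, hΦl, hb, hc]
  have huc : ∀ x ∈ 𝒜 0, x * (u * f) = u * f * x := by
    intro x hx
    have h1 := hker (⟨x * u, zero_mul_mem ⟨x, hx⟩ u.2⟩ - ⟨u * x, mul_zero_mem ⟨x, hx⟩ u.2⟩) (by
      rw [map_sub, hΦl ⟨x, hx⟩, hΦr ⟨x, hx⟩, hu, one_mul, mul_one, sub_self])
    have h2 : (x * u - u * x) * (f : A) = 0 := h1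
    rw [sub_mul, sub_eq_zero] at h2
    rw [← mul_assoc, h2, mul_assoc, mul_assoc, hf.coe_comm hx]
  refine hf.exists_isTwist F (v := u * f) (mul_zero_mem f u.2) huc
    (by rw [mul_assoc, hf.coe_idem]) fun h0 => ?_
  have h1 := hΦr f u
  have h2 : (⟨u * f, mul_zero_mem f u.2⟩ : 𝒜 1) = 0 := Subtype.ext h0
  rw [h2, map_zero, hu, one_mul] at h1
  obtain ⟨x, hx⟩ := exists_ne (0 : M)
  apply hx
  have h3 := LinearMap.congr_fun h1 x
  rw [zeroAction_apply, hf.smul_eq] at h3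
  exact h3.symm

/-- The isomorphism is `x ↦ u ^ r ⊗ x`: linear because `u` commutes with `𝒜 0`, injective because
`u` is invertible in the block, onto because `a f` lies in `𝒜 0 f u ^ r`. -/
theorem IsTwist.isInvariant (F : FrobeniusStar 𝒜) {f : 𝒜 0} (hf : IsBlock M f) {u : A}
    (T : IsTwist 𝒜 (f : A) u) : IsInvariant 𝒜 M := by
  have := IsSimpleModule.nontrivial (𝒜 0) M
  have hf0 : (f : A) ≠ 0 := fun h => hf.ne_zero (Subtype.ext h)
  intro r
  have hur : u ^ r.val ∈ 𝒜 r := by simpa using T.pow_mem r.val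
  let L : M →ₗ[ℂ] Induced 𝒜 M :=
    { toFun := ind 𝒜 (u ^ r.val)
      map_add' := ind_add _
      map_smul' := fun c x => ind_smul c _ x }
  have hL : ∀ x, L x = ind 𝒜 (u ^ r.val) x := fun x => rfl
  have hLsmul : ∀ (b : 𝒜 0) (x : M), L (b • x) = (b : A) • L x := by
    intro b x
    rw [hL, hL, ind_zero_smul, mul_ind, (T.commute_pow b.2 _).eq]
  have hinj : Function.Injective L := by
    rw [← LinearMap.ker_eq_bot, LinearMap.ker_eq_bot']
    intro x hx
    by_contra hx0
    have h1 : ∀ y : M, ind 𝒜 (u ^ r.val) y = 0 := by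
      intro y
      obtain ⟨b, rfl⟩ := IsSimpleModule.toSpanSingleton_surjective (𝒜 0) hx0 y
      change L (b • x) = 0
      rw [hLsmul, hx, smul_zero]
    have h2 := F.mul_eq_zero_of_ind hf h1
    have h3 := T.mul_pow_mul_pow r 1
    rw [one_mul, mul_assoc, ← pow_add, add_comm, pow_add, ← mul_assoc,
      (T.commute_pow f.2 _).eq, h2, zero_mul] at h3
    exact hf0 h3.symm
  have hrange : LinearMap.range L = conjugate 𝒜 M r := by
    apply le_antisymm
    · rintro _ ⟨x, rfl⟩
      exact ind_mem_conjugate hur x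
    · rw [conjugate_eq_span, Submodule.span_le]
      rintro _ ⟨a, ha, x, rfl⟩
      obtain ⟨b, hb, hab⟩ := T.exists_eq_mul_pow ha
      refine ⟨(⟨b, hb⟩ * f : 𝒜 0) • x, ?_⟩
      rw [hL, ind_zero_smul, ← (T.commute_pow (⟨b, hb⟩ * f : 𝒜 0).2 _).eq,
        SetLike.GradeZero.coe_mul, ← hab, ← ind_zero_smul, hf.smul_eq]
  let e : M ≃ₗ[ℂ] conjugate 𝒜 M r := LinearEquiv.ofInjective L hinj ≪≫ₗ LinearEquiv.ofEq _ _ hrange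
  refine ⟨e.symm, fun a t => ?_⟩
  rw [LinearEquiv.symm_apply_eq]
  apply Subtype.ext
  have h1 : ∀ x : M, (e x : Induced 𝒜 M) = L x := fun x => rfl
  rw [h1, hLsmul, ← h1, LinearEquiv.apply_symm_apply]

end Invariant

/-! ### Extensions and their characters -/

section Characters

variable {m : ℕ} [NeZero m] {A : Type u} [Ring A] [Algebra ℂ A] [FiniteDimensional ℂ A]
  {𝒜 : ZMod m → Submodule ℂ A} [GradedAlgebra 𝒜]
  {M : Type v} [AddCommGroup M] [Module ℂ M] [Module (𝒜 0) M] [IsScalarTower ℂ (𝒜 0) M]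

theorem IsTwist.smul {f u : A} (T : IsTwist 𝒜 f u) {t : ℂ} (ht : t ^ m = 1) :
    IsTwist 𝒜 f (t • u) where
  mem_zero := T.mem_zero
  mem_one := Submodule.smul_mem _ _ T.mem_one
  comm_zero a ha := by rw [mul_smul_comm, T.comm_zero a ha, smul_mul_assoc]
  pow_eq := by rw [smul_pow, ht, one_smul, T.pow_eq]
  mul_eq := by rw [mul_smul_comm, T.mul_eq]

theorem FrobeniusStar.lam_mul_gradeProj [StarRing A] [StarModule ℂ A] (F : FrobeniusStar 𝒜)
    {r : ZMod m} {b : A} (hb : b ∈ 𝒜 (-r)) (a : A) : F.lam (gradeProj 𝒜 r a * b) = F.lam (a * b) := by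
  induction a using graded_induction 𝒜 with
  | hmem s a ha =>
    by_cases h : s = r
    · subst h
      rw [gradeProj_of_mem 𝒜 ha]
    · rw [gradeProj_of_mem_of_ne 𝒜 ha h, Submodule.coe_zero, zero_mul, map_zero]
      exact (F.lam_of_mem_of_ne (SetLike.mul_mem_graded ha hb)
        fun h0 => h (by rwa [← sub_eq_add_neg, sub_eq_zero] at h0)).symm
  | hadd x y hx hy => rw [map_add, Submodule.coe_add, add_mul, map_add, hx, hy, add_mul, map_add]

theorem FrobeniusStar.lam_mul_gradeProj_neg [StarRing A] [StarModule ℂ A] (F : FrobeniusStar 𝒜)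
    {r : ZMod m} {a : A} (ha : a ∈ 𝒜 r) (b : A) :
    F.lam (a * gradeProj 𝒜 (-r) b) = F.lam (a * b) := by
  induction b using graded_induction 𝒜 with
  | hmem s b hb =>
    by_cases h : s = -r
    · subst h
      rw [gradeProj_of_mem 𝒜 hb]
    · rw [gradeProj_of_mem_of_ne 𝒜 hb h, Submodule.coe_zero, mul_zero, map_zero]
      exact (F.lam_of_mem_of_ne (SetLike.mul_mem_graded ha hb)
        fun h0 => h (eq_neg_of_add_eq_zero_right h0)).symm
  | hadd x y hx hy => rw [map_add, Submodule.coe_add, mul_add, map_add, hx, hy, mul_add, map_add]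

/-- The extension of `M` to `A` on which `u` acts as the identity. -/
noncomputable def IsTwist.extension [StarRing A] [StarModule ℂ A] (F : FrobeniusStar 𝒜) {f : 𝒜 0}
    (hf : IsBlock M f) {u : A} (T : IsTwist 𝒜 (f : A) u) : Extension 𝒜 M where
  action := AlgHom.ofLinearMap
    ((zeroAction 𝒜 M).toLinearMap ∘ₗ gradeProj 𝒜 0 ∘ₗ LinearMap.mulRight ℂ (cyclicSum m (f : A) u))
    (by
      have h : gradeProj 𝒜 0 (cyclicSum m (f : A) u) = f := Subtype.ext T.gradeProj_cyclicSum
      ext x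
      simp [h, hf.smul_eq])
    (fun a b => by
      have h : gradeProj 𝒜 0 (a * b * cyclicSum m (f : A) u) =
          gradeProj 𝒜 0 (a * cyclicSum m (f : A) u) *
            gradeProj 𝒜 0 (b * cyclicSum m (f : A) u) := by
        apply Subtype.ext
        rw [SetLike.GradeZero.coe_mul, ← coe_gradeProj_zero_mul 𝒜 (Subtype.prop _),
          mul_assoc, ← T.comm_cyclicSum F b, ← mul_assoc, ← mul_assoc,
          T.gradeProj_mul_cyclicSum_mul]
      simp only [LinearMap.comp_apply, LinearMap.mulRight_apply, h, AlgHom.toLinearMap_apply,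
        map_mul])
  action_zero a x := by
    have h : gradeProj 𝒜 0 (a * cyclicSum m (f : A) u) = a * f := by
      apply Subtype.ext
      rw [coe_gradeProj_zero_mul 𝒜 a.2, T.gradeProj_cyclicSum, SetLike.GradeZero.coe_mul]
    change zeroAction 𝒜 M (gradeProj 𝒜 0 (a * cyclicSum m (f : A) u)) x = a • x
    rw [h, zeroAction_apply, mul_smul, hf.smul_eq]

namespace Extension

variable (E : Extension 𝒜 M)

theorem smul_def (a : A) (x : E.Space) : a • x = E.action a x := rfl

theorem action_coe (a : 𝒜 0) : E.action (a : A) = zeroAction 𝒜 M a :=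
  LinearMap.ext fun x => E.action_zero a x

theorem twistedCharacter_mem : E.twistedCharacter ∈ twistedClassFunctionals 𝒜 1 := by
  intro a x
  change LinearMap.trace ℂ M (E.action ((a : A) * x)) = LinearMap.trace ℂ M (E.action ((x : A) * a))
  rw [map_mul E.action, map_mul E.action, LinearMap.trace_mul_comm]

theorem extendByZero_twistedCharacter (x : A) :
    extendByZero 𝒜 1 E.twistedCharacter x = E.character (gradeProj 𝒜 1 x) := rfl

theorem action_idem {f : 𝒜 0} (hf : IsBlock M f) : E.action (f : A) = 1 := by
  rw [action_coe]
  exact LinearMap.ext hf.smul_eq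

theorem isSimpleModule_space [IsSimpleModule (𝒜 0) M] : IsSimpleModule A E.Space := by
  have := IsSimpleModule.nontrivial (𝒜 0) M
  have hsurj : ∀ x : M, x ≠ 0 → ∀ y : M, ∃ b : 𝒜 0, b • x = y := fun x hx y =>
    IsSimpleModule.toSpanSingleton_surjective (𝒜 0) hx y
  refine isSimpleModule_iff_toSpanSingleton_surjective.2 ⟨‹Nontrivial M›, fun x hx y => ?_⟩
  obtain ⟨b, hb⟩ := hsurj x hx y
  refine ⟨b, ?_⟩
  exact (E.action_zero b x).trans hb

theorem action_cyclicSum {f : 𝒜 0} (hf : IsBlock M f) {u : A} (hu : E.action u = 1) :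
    E.action (cyclicSum m (f : A) u) = (m : ℂ) • 1 := by
  rw [cyclicSum, map_sum, Nat.cast_smul_eq_nsmul]
  simp [hu, E.action_idem hf]

/-- Let `E` act on `(a P)₀ P = a P`: here `P` acts as the scalar `m`, which cancels. -/
theorem action_eq {f : 𝒜 0} (hf : IsBlock M f) {u : A} (T : IsTwist 𝒜 (f : A) u)
    (hu : E.action u = 1) (a : A) :
    E.action a = zeroAction 𝒜 M (gradeProj 𝒜 0 (a * cyclicSum m (f : A) u)) := by
  have h := congrArg E.action (T.gradeProj_mul_cyclicSum_mul a)
  rw [map_mul E.action, map_mul E.action, E.action_cyclicSum hf hu, E.action_coe, mul_smul_comm, mul_smul_comm,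
    mul_one, mul_one] at h
  exact (smul_right_injective _ (Nat.cast_ne_zero.2 (NeZero.ne m)) h).symm

theorem mul_cyclicSum_eq_zero {f : 𝒜 0} (hf : IsBlock M f) {u : A} (T : IsTwist 𝒜 (f : A) u)
    (hu : E.action u = 1) {k : A} (hk : E.action k = 0) : k * cyclicSum m (f : A) u = 0 := by
  rw [E.action_eq hf T hu] at hk
  have h := hf.mul_eq_zero_of_smul fun x => LinearMap.congr_fun hk x
  have h2 : (gradeProj 𝒜 0 (k * cyclicSum m (f : A) u) : A) * f = 0 := congrArg Subtype.val h
  rw [← T.gradeProj_mul_cyclicSum_mul, ← T.idem_mul_cyclicSum, ← mul_assoc,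
    T.idem_mul_cyclicSum, h2, zero_mul]

variable [IsSimpleModule (𝒜 0) M]

/-- By Schur `u` acts by a scalar `t`, and `u ^ m = f` acts as 1, so `t ^ m = 1` and `t⁻¹ • u` is
again a twist. -/
theorem exists_action_eq_one {f : 𝒜 0} (hf : IsBlock M f) {u : A} (T : IsTwist 𝒜 (f : A) u) :
    ∃ u', IsTwist 𝒜 (f : A) u' ∧ E.action u' = 1 := by
  have := finiteDimensional_of_isSimpleModule (𝒜 0) M
  have := IsSimpleModule.nontrivial (𝒜 0) M
  obtain ⟨t, ht⟩ := exists_eq_smul_of_commute (R := 𝒜 0) (E.action u) (fun r x => by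
    rw [← E.action_zero, ← E.action_zero, ← Module.End.mul_apply, ← Module.End.mul_apply,
      ← map_mul, ← map_mul, T.comm_zero r r.2])
  have ht' : E.action u = t • 1 := LinearMap.ext ht
  have htm : t ^ m = 1 := by
    have h := congrArg E.action T.pow_eq
    rw [map_pow, ht', smul_pow, one_pow, E.action_idem hf, ← sub_eq_zero] at h
    have h2 : (t ^ m - 1) • (1 : Module.End ℂ M) = 0 := by rw [sub_smul, one_smul, h]
    exact sub_eq_zero.1 ((smul_eq_zero.1 h2).resolve_right one_ne_zero)
  have ht0 : t ≠ 0 := by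
    rintro rfl
    rw [zero_pow (NeZero.ne m)] at htm
    exact zero_ne_one htm
  refine ⟨t⁻¹ • u, T.smul (by rw [inv_pow, htm, inv_one]), ?_⟩
  rw [map_smul, ht', smul_smul, inv_mul_cancel₀ ht0, one_smul]

variable [StarRing A] [StarModule ℂ A]

/-- The block idempotent `f` of an invariant simple module, the root `u` of `f` which acts as the
identity on the extension `E`, and the elements of `A` that represent the characters of `E`. -/
theorem exists_twist (F : FrobeniusStar 𝒜) (hM : IsInvariant 𝒜 M) :
    ∃ (f : 𝒜 0) (u : A) (κ : ℂ), IsBlock M f ∧ IsTwist 𝒜 (f : A) u ∧ E.action u = 1 ∧ κ ≠ 0 ∧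
      F.phi.symm E.character = κ • cyclicSum m (f : A) u ∧
      F.phi.symm (extendByZero 𝒜 1 E.twistedCharacter)
        = κ • ((f : A) * u ^ (-1 : ZMod m).val) := by
  have := F.isSemisimpleRing_zero
  obtain ⟨f, hf⟩ := exists_isBlock (R := 𝒜 0) (M := M)
  obtain ⟨u₀, T₀⟩ := hf.exists_isTwist_of_isInvariant F hM
  obtain ⟨u, T, hu⟩ := E.exists_action_eq_one hf T₀
  obtain ⟨κ, hκ0, hκ⟩ := F.exists_lam_mul_eq hf
  have key : ∀ a, E.character a = κ⁻¹ * F.lam (gradeProj 𝒜 0 (a * cyclicSum m (f : A) u)) := by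
    intro a
    have h1 : (gradeProj 𝒜 0 (a * cyclicSum m (f : A) u) : A) * f =
        gradeProj 𝒜 0 (a * cyclicSum m (f : A) u) := by
      rw [← coe_gradeProj_mul_zero 𝒜 f.2, mul_assoc, ← T.comm_idem_all F, T.idem_mul_cyclicSum]
    have h2 : E.character a = LinearMap.trace ℂ M (E.action a) := rfl
    rw [h2, E.action_eq hf T hu, eq_inv_mul_iff_mul_eq₀ hκ0, ← hκ, h1]
  refine ⟨f, u, κ⁻¹, hf, T, hu, inv_ne_zero hκ0, ?_, ?_⟩
  · rw [LinearEquiv.symm_apply_eq]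
    ext a
    rw [map_smul, LinearMap.smul_apply, F.phi_apply, key, F.lam_gradeProj, smul_eq_mul]
  · rw [LinearEquiv.symm_apply_eq]
    ext a
    -- Having degree -1, this element pairs under `λ` only with degree 1, so the projection of `a`
    -- can be dropped.
    have hy : (f : A) * u ^ (-1 : ZMod m).val ∈ 𝒜 (-1) := by
      have h := T.pow_mem (-1 : ZMod m).val
      rw [ZMod.natCast_zmod_val] at h
      exact zero_mul_mem f h
    rw [map_smul, LinearMap.smul_apply, F.phi_apply, E.extendByZero_twistedCharacter, key,
      smul_eq_mul, T.gradeProj_mul_cyclicSum (gradeProj 𝒜 1 a).2, mul_assoc,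
      F.lam_mul_gradeProj hy]

end Extension

theorem FrobeniusStar.form_smul_smul [StarRing A] [StarModule ℂ A] (F : FrobeniusStar 𝒜)
    (c d : ℂ) (a b : A) :
    F.form (c • a) (d • b) = c * (starRingEnd ℂ) d * F.form a b := by
  simp only [FrobeniusStar.form, star_smul, smul_mul_assoc, mul_smul_comm, map_smul, smul_eq_mul,
    starRingEnd_apply]
  ring

variable [StarRing A] [StarModule ℂ A]

theorem nonempty_extension (F : FrobeniusStar 𝒜) [IsSimpleModule (𝒜 0) M]
    (hM : IsInvariant 𝒜 M) : Nonempty (Extension 𝒜 M) := by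
  have := F.isSemisimpleRing_zero
  obtain ⟨f, hf⟩ := exists_isBlock (R := 𝒜 0) (M := M)
  obtain ⟨u, T⟩ := hf.exists_isTwist_of_isInvariant F hM
  exact ⟨T.extension F hf⟩

theorem Extension.exists_dualForm_eq (F : FrobeniusStar 𝒜) [IsSimpleModule (𝒜 0) M]
    (hM : IsInvariant 𝒜 M) (E : Extension 𝒜 M) :
    ∃ (e : A) (c : ℂ), E.IsCentralIdempotent e ∧ F.phi.symm E.character = c • e ∧
      F.dualForm 1 E.twistedCharacter E.twistedCharacter
        = ((‖c‖ ^ 2 : ℝ) : ℂ) * F.form e e / (m : ℂ) := by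
  obtain ⟨f, u, κ, hf, T, hu, -, hchar, htw⟩ := E.exists_twist F hM
  have hm : (m : ℂ) ≠ 0 := Nat.cast_ne_zero.2 (NeZero.ne m)
  set P := cyclicSum m (f : A) u with hP
  set e : A := (m : ℂ)⁻¹ • P with he
  have hidem : e * e = e := by
    rw [he, smul_mul_assoc, mul_smul_comm, T.cyclicSum_mul_cyclicSum, smul_smul _ (m : ℂ),
      inv_mul_cancel₀ hm, one_smul]
  have hcomm : ∀ a, e * a = a * e := fun a => by
    rw [he, smul_mul_assoc, mul_smul_comm, T.comm_cyclicSum F]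
  have hEe : E.action e = 1 := by
    rw [he, map_smul, E.action_cyclicSum hf hu, smul_smul, inv_mul_cancel₀ hm, one_smul]
  have hstar : star e = e := F.star_eq_of_idem hidem (hcomm _)
  have hcentral : E.IsCentralIdempotent e := by
    refine ⟨Subring.mem_center_iff.2 fun a => (hcomm a).symm, hidem, ?_⟩
    have := F.isSemisimpleRing
    have := E.isSimpleModule_space
    -- Each of `e` and the block idempotent `e'` of the extension absorbs the other, so they
    -- coincide.
    obtain ⟨e', he'⟩ := exists_isBlock (R := A) (M := E.Space)
    have h1 : (1 - e) * e' = 0 := he'.mul_eq_zero_of_smul fun x => by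
      rw [E.smul_def, map_sub, map_one, hEe, sub_self]
      rfl
    have h2 : (1 - e') * e = 0 := by
      rw [he, mul_smul_comm, E.mul_cyclicSum_eq_zero hf T hu, smul_zero]
      refine LinearMap.ext fun x => ?_
      rw [map_sub, map_one, LinearMap.sub_apply, Module.End.one_apply]
      exact sub_eq_zero.2 (he'.smul_eq x).symm
    rw [sub_mul, one_mul, sub_eq_zero] at h1 h2
    rw [← he'.span_eq, h1, ← he'.comm, ← h2]
  -- The factor `m` appears because the character is represented by `κ • P` and `P = m • e`.
  refine ⟨e, κ * m, hcentral, ?_, ?_⟩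
  · rw [hchar, he, smul_smul, mul_assoc, mul_inv_cancel₀ hm, mul_one]
  · have h1 : F.form e e = (m : ℂ)⁻¹ * F.lam (f : A) := by
      rw [FrobeniusStar.form, hstar, hidem, he, map_smul, smul_eq_mul, ← F.lam_gradeProj P,
        T.gradeProj_cyclicSum]
    rw [FrobeniusStar.dualForm, htw, F.form_smul_smul, FrobeniusStar.form,
      T.mul_star_self_pow F hf, h1, Complex.mul_conj, Complex.normSq_eq_norm_sq, norm_mul,
      Complex.norm_natCast]
    push_cast
    field_simp

theorem dualForm_eq_zero (F : FrobeniusStar 𝒜) {N : Type w} [AddCommGroup N] [Module ℂ N]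
    [Module (𝒜 0) N] [IsScalarTower ℂ (𝒜 0) N] [IsSimpleModule (𝒜 0) M]
    [IsSimpleModule (𝒜 0) N] (hM : IsInvariant 𝒜 M) (hN : IsInvariant 𝒜 N)
    (h : ¬ Nonempty (M ≃ₗ[𝒜 0] N)) (E : Extension 𝒜 M) (E' : Extension 𝒜 N) :
    F.dualForm 1 E.twistedCharacter E'.twistedCharacter = 0 := by
  obtain ⟨f, u, κ, hf, T, -, -, -, htw⟩ := E.exists_twist F hM
  obtain ⟨f', u', κ', hf', T', -, -, -, htw'⟩ := E'.exists_twist F hN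
  have h0 : (f : A) * f' = 0 := congrArg Subtype.val (hf.mul_eq_zero_of_not_equiv hf' h)
  rw [FrobeniusStar.dualForm, htw, htw', F.form_smul_smul, FrobeniusStar.form,
    (T'.commute_pow f'.2 _).eq, star_mul, hf'.star_eq F, (T.commute_pow f.2 _).eq, mul_assoc (u ^ _),
    ← mul_assoc (f : A), h0, zero_mul, mul_zero, map_zero, mul_zero]

end Characters

/-! ### Twisted class functionals -/

section ClassFunctionals

variable {m : ℕ} [NeZero m] {A : Type u} [Ring A] [Algebra ℂ A] [FiniteDimensional ℂ A]
  {𝒜 : ZMod m → Submodule ℂ A} [GradedAlgebra 𝒜] [StarRing A] [StarModule ℂ A]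

theorem extendByZero_injective {γ δ : Module.Dual ℂ (𝒜 1)}
    (h : extendByZero 𝒜 1 γ = extendByZero 𝒜 1 δ) : γ = δ := by
  ext x
  have h1 := LinearMap.congr_fun h x
  have h2 : gradeProj 𝒜 1 (x : A) = x := Subtype.ext (gradeProj_of_mem 𝒜 x.2)
  simpa [extendByZero, h2] using h1

/-- The element of `A` which represents a functional on `𝒜 1`, as a linear map. -/
noncomputable def FrobeniusStar.rep (F : FrobeniusStar 𝒜) : Module.Dual ℂ (𝒜 1) →ₗ[ℂ] A :=
  F.phi.symm.toLinearMap ∘ₗ (gradeProj 𝒜 1).dualMap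

theorem FrobeniusStar.rep_apply (F : FrobeniusStar 𝒜) (γ : Module.Dual ℂ (𝒜 1)) :
    F.rep γ = F.phi.symm (extendByZero 𝒜 1 γ) := rfl

theorem FrobeniusStar.rep_injective (F : FrobeniusStar 𝒜) : Function.Injective F.rep :=
  fun _ _ h => extendByZero_injective (F.phi.symm.injective h)

theorem FrobeniusStar.lam_mul_rep (F : FrobeniusStar 𝒜) (γ : Module.Dual ℂ (𝒜 1)) (x : A) :
    F.lam (x * F.rep γ) = γ (gradeProj 𝒜 1 x) := by
  rw [← F.phi_apply, F.rep_apply, LinearEquiv.apply_symm_apply]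
  rfl

/-- Since `λ` pairs degree 1 only with degree -1, the degree -1 component represents the same
functional. -/
theorem FrobeniusStar.rep_mem (F : FrobeniusStar 𝒜) (γ : Module.Dual ℂ (𝒜 1)) :
    F.rep γ ∈ 𝒜 (-1) := by
  have h : F.rep γ = gradeProj 𝒜 (-1) (F.rep γ) := by
    apply F.phi.injective
    ext x
    rw [F.phi_apply, F.phi_apply, ← F.lam_mul_gradeProj (r := 1) (Subtype.prop _) x,
      F.lam_mul_gradeProj_neg (gradeProj 𝒜 1 x).2, F.lam_mul_rep, F.lam_mul_rep]
    exact congrArg γ (Subtype.ext (gradeProj_of_mem 𝒜 (Subtype.prop _)).symm)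
  rw [h]
  exact Subtype.prop _

theorem FrobeniusStar.rep_comm (F : FrobeniusStar 𝒜) {γ : Module.Dual ℂ (𝒜 1)}
    (hγ : γ ∈ twistedClassFunctionals 𝒜 1) {a : A} (ha : a ∈ 𝒜 0) :
    a * F.rep γ = F.rep γ * a := by
  apply F.phi.injective
  ext x
  rw [F.phi_apply, F.phi_apply, ← mul_assoc, ← mul_assoc, ← F.lam_mul_comm ha, ← mul_assoc,
    F.lam_mul_rep, F.lam_mul_rep]
  have h := hγ ⟨a, ha⟩ (gradeProj 𝒜 1 x)
  convert h.symm using 2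
  · exact Subtype.ext (coe_gradeProj_mul_zero 𝒜 ha x 1)
  · exact Subtype.ext (coe_gradeProj_zero_mul 𝒜 ha x 1)

theorem exists_simple_ideal_mul_ne_zero {R : Type*} [Ring R] [IsSemisimpleRing R] {h : R}
    (hh : h ≠ 0) : ∃ S : Submodule R R, IsSimpleModule R S ∧ ∃ s ∈ S, h * s ≠ 0 := by
  by_contra! H
  have h1 : (1 : R) ∈ sSup {S : Submodule R R | IsSimpleModule R S} := by
    rw [IsSemisimpleModule.sSup_simples_eq_top]
    trivial
  rw [sSup_eq_iSup'] at h1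
  apply hh
  rw [← mul_one h]
  exact Submodule.iSup_induction _ (motive := fun x => h * x = 0) h1
    (fun S x hx => H S.1 S.2 x hx) (mul_zero h) fun x y hx hy => by rw [mul_add, hx, hy, add_zero]

variable {ι : Type w} {M : ι → Type v} [∀ i, AddCommGroup (M i)] [∀ i, Module ℂ (M i)]
  [∀ i, Module (𝒜 0) (M i)] [∀ i, IsScalarTower ℂ (𝒜 0) (M i)] [∀ i, IsSimpleModule (𝒜 0) (M i)]

/-- Multiplying a relation by the block idempotent `f j` isolates its `j`-th term, which is nonzero
by `mul_star_self_pow`. -/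
theorem linearIndependent_twistedCharacter (F : FrobeniusStar 𝒜)
    (hinv : ∀ i, IsInvariant 𝒜 (M i)) (hne : ∀ i j, Nonempty (M i ≃ₗ[𝒜 0] M j) → i = j)
    (E : ∀ i, Extension 𝒜 (M i)) : LinearIndependent ℂ (fun i => (E i).twistedCharacter) := by
  choose f u κ hf T hu hκ hchar htw using fun i => (E i).exists_twist F (hinv i)
  rw [linearIndependent_iff']
  intro s g hg j hj
  have h1 := congrArg (fun γ => F.rep γ * f j) hg
  simp only [← F.rep_apply] at htw
  simp only [map_sum, map_smul, map_zero, zero_mul, Finset.sum_mul, htw] at h1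
  rw [Finset.sum_eq_single_of_mem j hj] at h1
  · have h2 := (T j).mul_star_self_pow F (hf j) (-1 : ZMod m).val
    have hy : (f j : A) * u j ^ (-1 : ZMod m).val * f j = f j * u j ^ (-1 : ZMod m).val := by
      rw [← (T j).comm_idem_all F, ← mul_assoc, (hf j).coe_idem]
    rw [smul_mul_assoc, smul_mul_assoc, hy, smul_smul] at h1
    rcases smul_eq_zero.1 h1 with h3 | h3
    · exact (mul_eq_zero.1 h3).resolve_right (hκ j)
    · rw [h3, zero_mul] at h2
      have := IsSimpleModule.nontrivial (𝒜 0) (M j)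
      exact ((hf j).ne_zero (Subtype.ext h2.symm)).elim
  · intro i _ hij
    have h0 : (f i : A) * f j = 0 :=
      congrArg Subtype.val ((hf i).mul_eq_zero_of_not_equiv (hf j) fun h => hij (hne i j h))
    rw [smul_mul_assoc, smul_mul_assoc, ((T i).commute_pow (f i).2 _).eq, mul_assoc, h0,
      mul_zero, smul_zero, smul_zero]

theorem span_twistedCharacter (F : FrobeniusStar 𝒜)
    (hinv : ∀ i, IsInvariant 𝒜 (M i)) (hne : ∀ i j, Nonempty (M i ≃ₗ[𝒜 0] M j) → i = j)
    (hall : ∀ (S : Type u) [AddCommGroup S] [Module ℂ S] [Module (𝒜 0) S]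
      [IsScalarTower ℂ (𝒜 0) S], IsSimpleModule (𝒜 0) S → IsInvariant 𝒜 S →
        ∃ i, Nonempty (S ≃ₗ[𝒜 0] M i))
    (E : ∀ i, Extension 𝒜 (M i)) :
    Submodule.span ℂ (Set.range fun i => (E i).twistedCharacter)
      = twistedClassFunctionals 𝒜 1 := by
  apply le_antisymm
  · rw [Submodule.span_le]
    rintro _ ⟨i, rfl⟩
    exact (E i).twistedCharacter_mem
  intro γ hγ
  have : Finite ι := (linearIndependent_twistedCharacter F hinv hne E).finite
  have := Fintype.ofFinite ι
  choose f u κ hf T hu hκ hchar htw using fun i => (E i).exists_twist F (hinv i)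
  have hf0 : ∀ i j, i ≠ j → (f i : A) * f j = 0 := fun i j hij =>
    congrArg Subtype.val ((hf i).mul_eq_zero_of_not_equiv (hf j) fun h => hij (hne i j h))
  set z := F.rep γ with hz
  have hzmem : z ∈ 𝒜 (-1) := F.rep_mem γ
  have hzcomm : ∀ a ∈ 𝒜 0, a * z = z * a := fun a ha => F.rep_comm hγ ha
  have hpart : ∀ i, ∃ c : ℂ, z * f i = c • F.rep (E i).twistedCharacter := by
    intro i
    -- Multiplying by `u i` brings `z f` to degree 0, where Schur applies; a further `u ^ (-1)`
    -- undoes it.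
    obtain ⟨c, hc⟩ : ∃ c : ℂ, z * f i * u i = c • (f i : A) := by
      refine (hf i).exists_eq_smul ?_ (fun a ha => ?_) ?_
      · simpa using SetLike.mul_mem_graded (mul_zero_mem (f i) hzmem) (T i).mem_one
      · rw [mul_assoc, ← mul_assoc a, hzcomm a ha, mul_assoc, ← mul_assoc a,
          ← (T i).comm_idem_all F, mul_assoc, (T i).comm_zero a ha]
        simp only [mul_assoc]
      · rw [mul_assoc, ← (T i).comm_zero _ (f i).2, (T i).mul_eq, mul_assoc, (T i).mul_eq]
    refine ⟨c * (κ i)⁻¹, ?_⟩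
    rw [F.rep_apply, htw, smul_smul, inv_mul_cancel_right₀ (hκ i), ← smul_mul_assoc, ← hc,
      mul_assoc, ← pow_succ', mul_assoc, (T i).idem_mul_pow_of_dvd]
    rw [← ZMod.natCast_eq_zero_iff]
    simp
  choose c hc using hpart
  have hsum : z = ∑ i, z * f i := by
    rw [← sub_eq_zero]
    set z' := z - ∑ i, z * (f i : A) with hz'
    have hz'mem : z' ∈ 𝒜 (-1) :=
      sub_mem hzmem (sum_mem fun i _ => mul_zero_mem (f i) hzmem)
    have hz'comm : ∀ a ∈ 𝒜 0, a * z' = z' * a := by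
      intro a ha
      rw [hz', mul_sub, sub_mul, hzcomm a ha, Finset.mul_sum, Finset.sum_mul]
      congr 1
      refine Finset.sum_congr rfl fun i _ => ?_
      rw [← mul_assoc, hzcomm a ha, mul_assoc, mul_assoc, (hf i).coe_comm ha]
    have hz'f : ∀ j, z' * f j = 0 := by
      intro j
      rw [hz', sub_mul, Finset.sum_mul, Finset.sum_eq_single j, mul_assoc, (hf j).coe_idem,
        sub_self]
      · intro i _ hij
        rw [mul_assoc, hf0 i j hij, mul_zero]
      · simp
    have hss := F.isSemisimpleRing_zero
    by_contra hne0
    have hmem : star z' * z' ∈ 𝒜 0 := by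
      simpa using SetLike.mul_mem_graded (F.star_mem _ _ hz'mem) hz'mem
    have hmem0 : (⟨star z' * z', hmem⟩ : 𝒜 0) ≠ 0 := fun h =>
      hne0 (F.eq_zero_of_star_mul (congrArg Subtype.val h))
    -- Taking `S` as a left ideal of `𝒜 0` places it in the universe over which `hall` ranges.
    obtain ⟨S, hS, s, hs, hhs⟩ := exists_simple_ideal_mul_ne_zero hmem0
    obtain ⟨g, hg⟩ := exists_isBlock (R := 𝒜 0) (M := S)
    have hzg : z' * g ≠ 0 := by
      intro h0
      apply hhs
      have h1 : g * s = s := congrArg Subtype.val (hg.smul_eq ⟨s, hs⟩)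
      rw [← h1, ← mul_assoc]
      refine (congrArg (· * s) ?_).trans (zero_mul s)
      apply Subtype.ext
      change star z' * z' * (g : A) = 0
      rw [mul_assoc, h0, mul_zero]
    have hcomm' := F.comm_star hz'comm
    -- The adjoint moves the remainder to degree 1. Its nonzero part in the block of `S` yields a
    -- twist, so `S` is invariant and hence some `M i`, whose block `z'` annihilates.
    obtain ⟨v, hv⟩ := hg.exists_isTwist F (v := star z' * g)
      (mul_zero_mem g (by simpa using F.star_mem _ _ hz'mem))
      (fun a ha => by
        rw [← mul_assoc, hcomm' a ha, mul_assoc, ← hg.coe_comm ha, mul_assoc])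
      (by rw [mul_assoc, hg.coe_idem])
      (fun h0 => hzg (by
        have h1 := congrArg star h0
        rwa [star_mul, star_star, hg.star_eq F, star_zero, hz'comm _ g.2] at h1))
    obtain ⟨i, ⟨e⟩⟩ := hall S hS (hv.isInvariant F hg)
    apply hzg
    have h1 : (1 - f i) * g = 0 := hg.mul_eq_zero_of_smul fun x => e.injective (by
      rw [map_smul, map_zero, sub_smul, one_smul, (hf i).smul_eq, sub_self])
    rw [sub_mul, one_mul, sub_eq_zero] at h1
    rw [h1, SetLike.GradeZero.coe_mul, ← mul_assoc, hz'f, zero_mul]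
  have hγ' : γ = ∑ i, c i • (E i).twistedCharacter := by
    apply F.rep_injective
    rw [← hz, hsum, map_sum]
    refine Finset.sum_congr rfl fun i _ => ?_
    rw [map_smul, hc]
  rw [hγ']
  exact sum_mem fun i _ => Submodule.smul_mem _ _ (Submodule.subset_span ⟨i, rfl⟩)

end ClassFunctionals

end TwistedFrobenius

open TwistedFrobenius in
theorem theorem4p11 {m : ℕ} [NeZero m] {A : Type u} [Ring A] [Algebra ℂ A]
    [FiniteDimensional ℂ A] [StarRing A] [StarModule ℂ A]
    (𝒜 : ZMod m → Submodule ℂ A) [GradedAlgebra 𝒜] (F : FrobeniusStar 𝒜) :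
    -- every invariant simple module extends to `A`, so that twisted characters exist
    (∀ (M : Type v) [AddCommGroup M] [Module ℂ M] [Module (𝒜 0) M] [IsScalarTower ℂ (𝒜 0) M],
      IsSimpleModule (𝒜 0) M → IsInvariant 𝒜 M → Nonempty (Extension 𝒜 M)) ∧
    -- the norm formula, where `e` and `c` are determined by the first two conditions
    (∀ (M : Type v) [AddCommGroup M] [Module ℂ M] [Module (𝒜 0) M] [IsScalarTower ℂ (𝒜 0) M],
      IsSimpleModule (𝒜 0) M → IsInvariant 𝒜 M → ∀ E : Extension 𝒜 M,
        ∃ (e : A) (c : ℂ), E.IsCentralIdempotent e ∧ F.phi.symm E.character = c • e ∧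
          F.dualForm 1 E.twistedCharacter E.twistedCharacter
            = ((‖c‖ ^ 2 : ℝ) : ℂ) * F.form e e / (m : ℂ)) ∧
    -- orthogonality
    (∀ (M N : Type v) [AddCommGroup M] [Module ℂ M] [Module (𝒜 0) M] [IsScalarTower ℂ (𝒜 0) M]
      [AddCommGroup N] [Module ℂ N] [Module (𝒜 0) N] [IsScalarTower ℂ (𝒜 0) N],
      IsSimpleModule (𝒜 0) M → IsInvariant 𝒜 M → IsSimpleModule (𝒜 0) N → IsInvariant 𝒜 N →
        ¬ Nonempty (M ≃ₗ[𝒜 0] N) → ∀ (E : Extension 𝒜 M) (E' : Extension 𝒜 N),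
          F.dualForm 1 E.twistedCharacter E'.twistedCharacter = 0) ∧
    -- for every system `M` of representatives of the isomorphism classes of invariant simple
    -- modules, and every choice of extensions, the twisted characters form an orthogonal basis
    (∀ (ι : Type w) (M : ι → Type v) [∀ i, AddCommGroup (M i)] [∀ i, Module ℂ (M i)]
      [∀ i, Module (𝒜 0) (M i)] [∀ i, IsScalarTower ℂ (𝒜 0) (M i)],
      (∀ i, IsSimpleModule (𝒜 0) (M i)) → (∀ i, IsInvariant 𝒜 (M i)) →
      (∀ i j, Nonempty (M i ≃ₗ[𝒜 0] M j) → i = j) →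
      (∀ (S : Type u) [AddCommGroup S] [Module ℂ S] [Module (𝒜 0) S] [IsScalarTower ℂ (𝒜 0) S],
        IsSimpleModule (𝒜 0) S → IsInvariant 𝒜 S → ∃ i, Nonempty (S ≃ₗ[𝒜 0] M i)) →
      ∀ E : ∀ i, Extension 𝒜 (M i),
        (∀ i j, i ≠ j →
          F.dualForm 1 (E i).twistedCharacter (E j).twistedCharacter = 0) ∧
        LinearIndependent ℂ (fun i => (E i).twistedCharacter) ∧
        Submodule.span ℂ (Set.range fun i => (E i).twistedCharacter)
          = twistedClassFunctionals 𝒜 1) := by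
  refine ⟨?_, ?_, ?_, ?_⟩
  · intro M _ _ _ _ _ hM
    exact nonempty_extension F hM
  · intro M _ _ _ _ _ hM E
    exact E.exists_dualForm_eq F hM
  · intro M N _ _ _ _ _ _ _ _ _ hM _ hN h E E'
    exact dualForm_eq_zero F hM hN h E E'
  · intro ι M _ _ _ _ hsimple hinv hne hall E
    exact ⟨fun i j hij => dualForm_eq_zero F (hinv i) (hinv j) (fun h => hij (hne i j h)) _ _,
      linearIndependent_twistedCharacter F hinv hne E, span_twistedCharacter F hinv hne hall E⟩
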